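/- **Theorem.** Let $k\ge 3$ be an integer and let $\Gamma$ be one of $\Gamma_1(4)$, $\Gamma(4)$, $\Gamma_1(8)$. Put $K=\mathbb{Q}$ for $\Gamma=\Gamma_1(4)$ and for $\Gamma=\Gamma(4)$, and $K=\mathbb{Q}(\sqrt2)$ for $\Gamma=\Gamma_1(8)$. Let $\mathcal{E}_k(\Gamma)$ be the weight $k$ Eisenstein space, that is, the space of the modular forms of weight $k$ on $\Gamma$ that are complex linear combinations of the Eisenstein series $$\sum_{\substack{(c,d)\equiv a \ (\mathrm{mod}\ N)\\ \gcd(c,d)=1}}\frac{1}{(c\tau+d)^{k}},\qquad a\in(\mathbb{Z}/N\mathbb{Z})^2,$$ where $N=4$ for $\Gamma_1(4)$ and $\Gamma(4)$, and $N=8$ for $\Gamma_1(8)$. Let $\mathcal{E}_k^{(0,\infty)}(\Gamma;K)$ be the set of those $f\in\mathcal{E}_k(\Gamma)$ that vanish at the cusps $0$ and $\infty$ and whose $q$-coefficients lie in $K$ (the expansion being in powers of $e^{2\pi i\tau/4}$ for $\Gamma(4)$, and of $e^{2\pi i\tau}$ for $\Gamma_1(4)$ and $\Gamma_1(8)$).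 For such $f$ let $$L(f,s)=\frac{(2\pi)^s}{\Gamma(s)}\int_0^\infty f(ix)\,x^{s}\,\frac{dx}{x}.$$ Let $L_{D}(s)=\sum_{n\ge1}\left(\frac{D}{n}\right)n^{-s}$ for $D\in\{-4,8,-8\}$, where $\left(\frac{D}{\cdot}\right)$ is the Kronecker symbol. Then $$\operatorname{Span}_K\left\{(2\pi)^{k-1-s}L(f,s)\ \middle|\ s\in\{1,\dots,k-1\},\ f\in\mathcal{E}_k^{(0,\infty)}(\Gamma;K)\right\}$$ is contained in the $K$-span of the following numbers: $$\begin{cases} \{\pi^{k-1},\ \zeta(k-1)\} & k \text{ even and } \Gamma=\Gamma_1(4),\\ \varnothing \ (\text{so the span is } \{0\}) & k \text{ odd and } \Gamma=\Gamma_1(4),\\ \{\pi^{k-1},\ \zeta(k-1)\} & k \text{ even and } \Gamma=\Gamma(4),\\ \{\pi^{k-1},\ L_{-4}(k-1)\} & k \text{ odd and } \Gamma=\Gamma(4),\\ \{\pi^{k-1},\ \zeta(k-1),\ L_8(k-1)\} & k \text{ even and } \Gamma=\Gamma_1(8),\\ \{\pi^{k-1},\ L_{-4}(k-1),\ L_{-8}(k-1)\}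 & k \text{ odd and } \Gamma=\Gamma_1(8). \end{cases}$$ -/

import Mathlib

open scoped MatrixGroups CongruenceSubgroup IntermediateField Real

noncomputable section

/-- A function on the upper half-plane lies in the weight `k` Eisenstein space of level `Γ(N)`: it is
a complex linear combination of the Eisenstein series
`∑ (c τ + d) ^ (-k)`, the sum over coprime `(c, d)` congruent to `a` modulo `N`, where `a` runs
through all pairs of residues modulo `N`. (The series is zero if `a` is not of order `N`.) -/
def IsEisenstein (N : ℕ) (k : ℤ) (f : UpperHalfPlane → ℂ) : Prop :=
  f ∈ Submodule.span ℂ (Set.range fun a : Fin 2 → ZMod N => eisensteinSeries a k)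

/-- All coefficients of the expansion of `f` in `q_h = exp (2 π i τ / h)` are in `K`, where `h` is the
width of the cusp `∞` of `Γ`, i.e. the least `h > 0` with `(1 h; 0 1) ∈ Γ`
(`1` for `Γ₁(N)`, and `N` for `Γ(N)`). -/
def HasCoeffsIn (K : IntermediateField ℚ ℂ) (Γ : Subgroup SL(2, ℤ)) (f : UpperHalfPlane → ℂ) : Prop :=
  ∀ n : ℕ, (UpperHalfPlane.qExpansion
    (Γ : Subgroup (GL (Fin 2) ℝ)).strictWidthInfty f).coeff n ∈ K

/-- `ℰ_k^{(0,∞)}(Γ; K)` for a group `Γ` containing `Γ(N)`: the modular forms of weight `k` on `Γ` that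
are in the Eisenstein space, vanish at the cusps `0` and `∞`, and have `q`-coefficients in `K`. -/
def eisensteinZeroInfty (K : IntermediateField ℚ ℂ) (Γ : Subgroup SL(2, ℤ)) (N : ℕ) (k : ℤ) :
    Set (ModularForm (Γ : Subgroup (GL (Fin 2) ℝ)) k) :=
  {f | IsEisenstein N k f ∧
    OnePoint.IsZeroAt ((0 : ℝ) : OnePoint ℝ) f k ∧ OnePoint.IsZeroAt OnePoint.infty f k ∧
    HasCoeffsIn K Γ f}

/-- The `K`-span of the numbers `(2π)^(k-1-s) L(f,s)` with `s ∈ {1, …, k-1}` and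
`f ∈ ℰ_k^{(0,∞)}(Γ; K)`. Here `L(f,s)` is Mathlib's (analytically continued) `ModularForm.L`; for `f`
vanishing at `0` and `∞` it is `(2π)^s / Γ(s) * ∫ x in (0,∞), f(ix) x^(s-1)`. -/
def eisensteinLSpan (K : IntermediateField ℚ ℂ) (Γ : Subgroup SL(2, ℤ)) [Γ.FiniteIndex]
    (N k : ℕ) (hk : 0 < (k : ℤ)) : Submodule K ℂ :=
  Submodule.span K {z : ℂ | ∃ s : ℕ, 1 ≤ s ∧ s ≤ k - 1 ∧
    ∃ f ∈ eisensteinZeroInfty K Γ N k,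
      z = (2 * (π : ℂ)) ^ (k - 1 - s) * ModularForm.L hk f (s : ℂ)}

/-- `L_{-4}(s) = ∑ (-4/n) n^{-s}`. -/
def LNegFour (s : ℂ) : ℂ := LSeries (fun n : ℕ => ((ZMod.χ₄ n : ℤ) : ℂ)) s

/-- `L_8(s) = ∑ (8/n) n^{-s}`. -/
def LEight (s : ℂ) : ℂ := LSeries (fun n : ℕ => ((ZMod.χ₈ n : ℤ) : ℂ)) s

/-- `L_{-8}(s) = ∑ (-8/n) n^{-s}`. -/
def LNegEight (s : ℂ) : ℂ := LSeries (fun n : ℕ => ((ZMod.χ₈' n : ℤ) : ℂ)) s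

/-- `ℚ(√2)` as a subfield of `ℂ`. -/
abbrev QSqrtTwo : IntermediateField ℚ ℂ := ℚ⟮((√2 : ℝ) : ℂ)⟯

/-- `ℚ` as a subfield of `ℂ`. -/
abbrev QField : IntermediateField ℚ ℂ := ⊥

end

/-! Möbius inversion turns an Eisenstein series into a sum over all of `ℤ²` with weights periodic
mod `N`. Lipschitz' formula then gives coefficients `∑_{xy=n} φ(x,y) y^(k-1)` in `exp(2πiτ/N)`, with
`φ` periodic of parity `(-1)^k`. A `K`-linear retraction of `ℂ` onto `K` makes `φ` `K`-valued
(`exists_periodic_coeff`). Hence `N^(-s) L(f,s)` is a `K`-combination of products `L(A,s)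
L(B,s-k+1)` with periodic `A`, `B` (`exists_bilinearL_eq`), and the parity of `φ` leaves only pairs
whose parities differ by that of `k`.

At an integer `1 ≤ s ≤ k-1` each product is evaluated by parity (`exists_tendsto_LFunction_mul`). If
`A` has the parity of `s`, then `L(A,s)` lies in `K (2π)^s` and the other factor in `K`, which
yields `π^(k-1)`. If not, the second factor is a trivial zero for `1 < s < k-1`. At `s = k-1` it is
`-B(0)/2`, leaving `L(A,k-1)`; at `s = 1` the possible pole of `L(A,s)` meets a trivial zero, and
the functional equation turns the limit into a multiple of `L(𝓕 B,k-1)`. So `π^(k-1)` and the values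
at `k-1` of `L`-functions of periodic functions of parity `k` suffice
(`eisensteinLSpan_le_valueSpan`). For `N = 4, 8` such functions are combinations of dilated
characters, which gives the lists.

For `Γ₁(4)` and odd `k` the third cusp is irregular, so a form vanishing at `0` and `∞` vanishes at
every cusp and is zero (`eq_zero_of_mem_eisensteinZeroInfty_Gamma1_four`). -/

noncomputable section

/-! ### Möbius inversion: from coprime pairs to full lattice sums. -/

open UpperHalfPlane hiding I
open EisensteinSeries Complex ArithmeticFunction

/-- The sum `∑ ψ(v mod N) (v₀ τ + v₁) ^ (-k)` over all `v` in `ℤ²`. -/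
def latticeSeries {N : ℕ} (k : ℕ) (ψ : (Fin 2 → ZMod N) → ℂ) (τ : ℍ) : ℂ :=
  ∑' v : Fin 2 → ℤ, ψ (fun i => (v i : ZMod N)) * eisSummand k v τ

lemma norm_apply_le_sum {α : Type*} [Fintype α] (ψ : α → ℂ) (x : α) : ‖ψ x‖ ≤ ∑ y, ‖ψ y‖ :=
  Finset.single_le_sum (f := fun y => ‖ψ y‖) (fun _ _ => norm_nonneg _) (Finset.mem_univ x)

lemma summable_norm_lattice {N : ℕ} [NeZero N] {k : ℕ} (hk : 3 ≤ k)
    (ψ : (Fin 2 → ZMod N) → ℂ) (τ : ℍ) :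
    Summable fun v : Fin 2 → ℤ => ‖ψ (fun i => (v i : ZMod N)) * eisSummand k v τ‖ := by
  refine Summable.of_nonneg_of_le (fun _ => norm_nonneg _) (fun v => ?_)
    ((summable_norm_eisSummand (k := k) (by exact_mod_cast hk) τ).mul_left (∑ y, ‖ψ y‖))
  rw [norm_mul]
  exact mul_le_mul_of_nonneg_right (norm_apply_le_sum ψ _) (norm_nonneg _)

lemma latticeSeries_add {N : ℕ} [NeZero N] {k : ℕ} (hk : 3 ≤ k)
    (ψ₁ ψ₂ : (Fin 2 → ZMod N) → ℂ) :
    latticeSeries k (ψ₁ + ψ₂) = latticeSeries k ψ₁ + latticeSeries k ψ₂ := by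
  ext τ
  simp only [latticeSeries, Pi.add_apply, add_mul]
  exact (summable_norm_lattice hk ψ₁ τ).of_norm.tsum_add (summable_norm_lattice hk ψ₂ τ).of_norm

lemma latticeSeries_smul {N : ℕ} {k : ℕ} (c : ℂ) (ψ : (Fin 2 → ZMod N) → ℂ) :
    latticeSeries k (c • ψ) = c • latticeSeries k ψ := by
  ext τ
  simp only [latticeSeries, Pi.smul_apply, smul_eq_mul, mul_assoc, tsum_mul_left]

lemma sum_divisors_moebius_eq_ite (n : ℕ) :
    ∑ d ∈ n.divisors, (moebius d : ℂ) = if n = 1 then 1 else 0 := by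
  have h := congrArg (fun f : ArithmeticFunction ℂ => f n)
    (coe_moebius_mul_coe_zeta (R := ℂ))
  simp only [coe_mul_zeta_apply, one_apply] at h
  simpa using h

lemma eisSummand_nsmul (k : ℕ) (d : ℕ) (v : Fin 2 → ℤ) (τ : ℍ) :
    eisSummand k ((d : ℤ) • v) τ = ((d : ℂ) ^ k)⁻¹ * eisSummand k v τ := by
  simp only [eisSummand, Pi.smul_apply, smul_eq_mul, Int.cast_mul, Int.cast_natCast, zpow_neg,
    zpow_natCast]
  rw [← mul_inv, ← mul_pow]
  ring_nf

lemma eisSummand_zero {k : ℕ} (hk : k ≠ 0) (τ : ℍ) : eisSummand k 0 τ = 0 := by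
  simp [eisSummand, hk]

/-- Möbius inversion: Eisenstein series over coprime pairs in terms of sums over all pairs. -/
lemma eisensteinSeries_eq_latticeSeries {N : ℕ} {k : ℕ} (hk : 3 ≤ k)
    (a : Fin 2 → ZMod N) :
    eisensteinSeries a k = latticeSeries k (fun b =>
      ∑' d : ℕ+, (moebius d : ℂ) * ((d : ℂ) ^ k)⁻¹ * (if (d : ZMod N) • b = a then 1 else 0)) := by
  classical
  ext τ
  -- The double sum over `d ∣ w`, evaluated in two ways: summing over `d` first detects coprimality
  -- of `w`, while substituting `w = d v` gives the lattice series.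
  let g : ℕ+ × (Fin 2 → ℤ) → ℂ := fun p => if (p.1 : ℤ) ∣ p.2 0 ∧ (p.1 : ℤ) ∣ p.2 1 then
    (moebius p.1 : ℂ) * ((if ((↑) ∘ p.2 : Fin 2 → ZMod N) = a then 1 else 0) * eisSummand k p.2 τ)
    else 0
  let i : ℕ+ × (Fin 2 → ℤ) → ℕ+ × (Fin 2 → ℤ) := fun p => (p.1, (p.1 : ℤ) • p.2)
  have hi : Function.Injective i := by
    rintro ⟨d, v⟩ ⟨d', v'⟩ h
    simp only [i, Prod.mk.injEq] at h
    obtain ⟨rfl, h⟩ := h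
    exact Prod.ext rfl (smul_right_injective _ (by positivity : ((d : ℕ) : ℤ) ≠ 0) h)
  have hsupp : Function.support g ⊆ Set.range i := by
    rintro ⟨d, w⟩ h
    have hd : ((d : ℕ) : ℤ) ∣ w 0 ∧ ((d : ℕ) : ℤ) ∣ w 1 := by
      by_contra hc
      exact h (if_neg hc)
    obtain ⟨⟨x, hx⟩, ⟨y, hy⟩⟩ := hd
    refine ⟨(d, ![x, y]), ?_⟩
    simp only [i, Prod.mk.injEq, true_and]
    ext j
    fin_cases j <;> simp [hx, hy]
  have hgi (d : ℕ+) (v : Fin 2 → ℤ) : g (i (d, v)) = ((moebius d : ℂ) * ((d : ℂ) ^ k)⁻¹ *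
      (if (d : ZMod N) • (fun i => (v i : ZMod N)) = a then 1 else 0)) * eisSummand k v τ := by
    have h1 : ((↑) ∘ (((d : ℕ) : ℤ) • v) : Fin 2 → ZMod N) =
        (d : ZMod N) • (fun i => (v i : ZMod N)) := by
      ext j; simp
    simp only [g, i, Pi.smul_apply, smul_eq_mul, dvd_mul_right, and_self, if_true, h1,
      eisSummand_nsmul]
    ring
  have hsum1 : Summable (g ∘ i) := by
    have hz : Summable fun d : ℕ+ => ‖((d : ℂ) ^ k)⁻¹‖ := by
      have := (Real.summable_nat_pow_inv (p := k)).mpr (by omega)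
      simpa using! this.comp_injective PNat.coe_injective
    refine Summable.of_norm_bounded (hz.mul_of_nonneg
      (summable_norm_eisSummand (k := k) (by exact_mod_cast hk) τ)
      (fun _ => norm_nonneg _) (fun _ => norm_nonneg _)) ?_
    rintro ⟨d, v⟩
    rw [Function.comp_apply, hgi, norm_mul]
    refine mul_le_mul_of_nonneg_right ?_ (norm_nonneg _)
    rw [norm_mul, norm_mul]
    have h1 : ‖((moebius d : ℤ) : ℂ)‖ ≤ 1 := by
      rw [Complex.norm_intCast]; exact_mod_cast abs_moebius_le_one
    have h2 : ‖(if (d : ZMod N) • (fun i => (v i : ZMod N)) = a then (1 : ℂ) else 0)‖ ≤ 1 := by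
      split_ifs <;> simp
    calc _ ≤ 1 * ‖((d : ℂ) ^ k)⁻¹‖ * 1 := by gcongr
      _ = _ := by ring
  have hsum : Summable g := (hi.summable_iff (fun x hx => by
    by_contra h; exact hx (hsupp h))).mp hsum1
  have e1 : ∑' p, g p = ∑' p, g (i p) := (hi.tsum_eq hsupp).symm
  have e2 : ∑' p, g (i p) = latticeSeries k (fun b => ∑' d : ℕ+, (moebius d : ℂ) *
      ((d : ℂ) ^ k)⁻¹ * (if (d : ZMod N) • b = a then 1 else 0)) τ := by
    rw [show ∑' p, g (i p) = _ from hsum1.tsum_prod, ← (show Summable (Function.uncurry fun d v => (g ∘ i) (d, v)) from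
      hsum1).tsum_comm, latticeSeries]
    exact tsum_congr fun v => by simp_rw [Function.comp_apply, hgi, tsum_mul_right]
  have e3 : ∑' p, g p = eisensteinSeries a k τ := by
    rw [hsum.tsum_prod, ← (show Summable (Function.uncurry fun d v => g (d, v)) from
      hsum).tsum_comm, eisensteinSeries, tsum_subtype (gammaSet N 1 a) (eisSummand k · τ)]
    refine tsum_congr fun w => ?_
    rcases eq_or_ne w 0 with rfl | hw
    · have h0 : ∀ d, g (d, 0) = 0 := fun d => by simp [g, eisSummand_zero (by omega : k ≠ 0)]
      simp [h0, Set.indicator, eisSummand_zero (by omega : k ≠ 0)]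
    set n := (w 0).gcd (w 1) with hn
    have hn0 : n ≠ 0 := by
      rw [hn, Ne, Int.gcd_eq_zero_iff]
      rintro ⟨h0, h1⟩
      exact hw (by ext j; fin_cases j <;> simp [h0, h1])
    have hdvd (d : ℕ+) : (((d : ℕ) : ℤ) ∣ w 0 ∧ ((d : ℕ) : ℤ) ∣ w 1) ↔ (d : ℕ) ∈ n.divisors := by
      rw [Nat.mem_divisors, ← Int.natCast_dvd_natCast, hn, Int.dvd_coe_gcd_iff]
      simp [hn0, ← hn]
    have h1 (d : ℕ+) : g (d, w) = (fun d : ℕ => if d ∈ n.divisors then (moebius d : ℂ) else 0) d *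
        ((if ((↑) ∘ w : Fin 2 → ZMod N) = a then 1 else 0) * eisSummand k w τ) := by
      simp only [g, hdvd, ite_mul, zero_mul]
    simp_rw [h1]
    have h2 : ∑' d : ℕ+, (fun d : ℕ => if d ∈ n.divisors then (moebius d : ℂ) else 0) d =
        if n = 1 then 1 else 0 := by
      rw [← sum_divisors_moebius_eq_ite, PNat.coe_injective.tsum_eq
        (f := fun d : ℕ => if d ∈ n.divisors then (moebius d : ℂ) else 0),
        tsum_eq_sum (s := n.divisors) (fun d hd => if_neg hd)]
      · exact Finset.sum_congr rfl fun d hd => if_pos hd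
      · intro d hd
        have : d ∈ n.divisors := by
          by_contra h
          exact hd (if_neg h)
        exact ⟨⟨d, Nat.pos_of_mem_divisors this⟩, rfl⟩
    rw [tsum_mul_right, h2]
    simp only [Set.indicator, gammaSet, Set.mem_ofPred_eq, ← hn]
    split_ifs <;> simp_all
  rw [← e3, e1, e2]

lemma IsEisenstein.exists_latticeSeries {N k : ℕ} [NeZero N] (hk : 3 ≤ k) {f : ℍ → ℂ}
    (hf : IsEisenstein N k f) : ∃ ψ : (Fin 2 → ZMod N) → ℂ, f = latticeSeries k ψ := by
  induction hf using Submodule.span_induction with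
  | mem x hx =>
    obtain ⟨a, rfl⟩ := hx
    exact ⟨_, eisensteinSeries_eq_latticeSeries hk a⟩
  | zero => exact ⟨0, by ext; simp [latticeSeries]⟩
  | add x y _ _ hx hy =>
    obtain ⟨ψ₁, rfl⟩ := hx
    obtain ⟨ψ₂, rfl⟩ := hy
    exact ⟨ψ₁ + ψ₂, (latticeSeries_add hk _ _).symm⟩
  | smul c x _ hx =>
    obtain ⟨ψ, rfl⟩ := hx
    exact ⟨c • ψ, (latticeSeries_smul _ _).symm⟩

end

/-! ### Fourier expansions of lattice series. -/

noncomputable section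

open UpperHalfPlane hiding I
open EisensteinSeries Complex ArithmeticFunction ZMod

lemma ZMod.sum_eq_sum_fin {N : ℕ} [NeZero N] (F : ZMod N → ℂ) :
    ∑ j, F j = ∑ r : Fin N, F ((r : ℕ) : ZMod N) := by
  refine (Fintype.sum_equiv
    { toFun := fun r : Fin N => ((r : ℕ) : ZMod N)
      invFun := fun j => ⟨j.val, j.val_lt⟩
      left_inv := fun r => Fin.ext (ZMod.val_cast_of_lt r.2)
      right_inv := fun j => ZMod.natCast_zmod_val j } _ _ fun r => rfl).symm

/-- Lipschitz' formula with periodic coefficients. -/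
lemma tsum_periodic_mul_zpow {N : ℕ} [NeZero N] (g : ZMod N → ℂ) {k : ℕ} (hk : 2 ≤ k) (z : ℍ) :
    ∑' d : ℤ, g d * ((z : ℂ) + d) ^ (-(k : ℤ)) =
      ∑' m : ℕ+, ((-2 * π * I) ^ k / ((k - 1).factorial : ℂ) * ((N : ℂ) ^ k)⁻¹ *
        ∑ j, g j * stdAddChar (j * ((m : ℕ) : ZMod N))) * (m : ℂ) ^ (k - 1) *
          cexp (2 * π * I * z / N) ^ (m : ℕ) := by
  have hN : (0 : ℝ) < N := by exact_mod_cast NeZero.pos N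
  have hN' : (N : ℂ) ≠ 0 := NeZero.ne _
  have hs : Summable fun d : ℤ => g d * ((z : ℂ) + d) ^ (-(k : ℤ)) := by
    have h := (linear_right_summable (z : ℂ) 1 (k := k) (by exact_mod_cast hk)).norm
    refine Summable.of_norm_bounded (h.mul_left (∑ y, ‖g y‖)) fun d => ?_
    rw [norm_mul]
    refine mul_le_mul (norm_apply_le_sum g _) (le_of_eq ?_) (norm_nonneg _)
      (Finset.sum_nonneg fun _ _ => norm_nonneg _)
    simp
  -- Writing `d = qN + r` gives `z + d = N (w r + q)`, so each residue class is a classical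
  -- Lipschitz sum at `w r`.
  let w (r : Fin N) : ℍ := ⟨((z : ℂ) + (r : ℕ)) / N, by
    have : (((z : ℂ) + (r : ℕ)) / N).im = z.im / N := by
      rw [← Complex.ofReal_natCast N, Complex.div_ofReal_im]; simp
    rw [this]; exact div_pos z.im_pos hN⟩
  have hw (r : Fin N) : (w r : ℂ) = ((z : ℂ) + (r : ℕ)) / N := rfl
  have hexp (r : Fin N) (m : ℕ) : cexp (2 * π * I * w r) ^ m =
      stdAddChar (((r : ℕ) : ZMod N) * (m : ZMod N)) * cexp (2 * π * I * z / N) ^ m := by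
    have := stdAddChar_coe (N := N) ((r : ℕ) * m : ℕ)
    push_cast at this
    rw [this, ← Complex.exp_nat_mul, ← Complex.exp_nat_mul, ← Complex.exp_add, hw]
    congr 1
    field_simp
    ring
  have hsumm (r : Fin N) : Summable fun m : ℕ+ => ((m : ℕ) : ℂ) ^ (k - 1) *
      cexp (2 * π * I * w r) ^ (m : ℕ) := by
    have := (summable_pow_mul_cexp (k - 1) 1 (w r)).comp_injective PNat.coe_injective
    simpa using! this
  have hs' := (Int.divModEquiv N).symm.summable_iff.mpr hs
  have hs'' : Summable (fun p : Fin N × ℤ => (fun d : ℤ => g d * ((z : ℂ) + d) ^ (-(k : ℤ)))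
      ((Int.divModEquiv N).symm (p.2, p.1))) := (Equiv.prodComm (Fin N) ℤ).summable_iff.mpr hs'
  rw [← (Int.divModEquiv N).symm.tsum_eq, ← (Equiv.prodComm (Fin N) ℤ).tsum_eq]
  refine hs''.tsum_prod.trans ?_
  rw [tsum_fintype]
  have hr (r : Fin N) : ∑' q : ℤ, g (((Int.divModEquiv N).symm (q, r) : ℤ)) *
      ((z : ℂ) + ((Int.divModEquiv N).symm (q, r) : ℤ)) ^ (-(k : ℤ)) =
      ∑' m : ℕ+, g ((r : ℕ) : ZMod N) * ((N : ℂ) ^ k)⁻¹ * ((-2 * π * I) ^ k / ((k - 1).factorial : ℂ)) *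
        (((m : ℕ) : ℂ) ^ (k - 1) * cexp (2 * π * I * w r) ^ (m : ℕ)) := by
    have h := qExpansion_identity_pnat (k := k - 1) (by omega) (w r)
    rw [show k - 1 + 1 = k by omega] at h
    rw [tsum_mul_left, mul_assoc, ← h, ← tsum_mul_left]
    refine tsum_congr fun q => ?_
    have h1 : (z : ℂ) + ((Int.divModEquiv N).symm (q, r) : ℤ) = N * ((w r : ℂ) + q) := by
      rw [hw, Int.divModEquiv_symm_apply]; push_cast; field_simp; ring
    rw [h1, Int.divModEquiv_symm_apply, zpow_neg, zpow_natCast, mul_pow, mul_inv]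
    simp
    ring
  refine (Finset.sum_congr rfl fun r _ => hr r).trans ?_
  rw [← Summable.tsum_finsetSum fun r _ => (hsumm r).mul_left _]
  refine tsum_congr fun m => ?_
  rw [ZMod.sum_eq_sum_fin, Finset.mul_sum, Finset.sum_mul, Finset.sum_mul]
  refine Finset.sum_congr rfl fun r _ => ?_
  rw [hexp]
  ring

/-- The `q`-expansion of a lattice series. -/
lemma exists_hasSum_latticeSeries {N : ℕ} [NeZero N] {k : ℕ} (hk : 3 ≤ k)
    (ψ : (Fin 2 → ZMod N) → ℂ) :
    ∃ (φ : ZMod N → ZMod N → ℂ) (a₀ : ℂ), (∀ x y, φ (-x) (-y) = (-1) ^ k * φ x y) ∧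
      ∀ τ : ℍ, HasSum (fun n : ℕ => (if n = 0 then a₀ else
        ∑ p ∈ n.divisorsAntidiagonal, φ p.1 p.2 * (p.2 : ℂ) ^ (k - 1)) *
          cexp (2 * π * I * τ / N) ^ n) (latticeSeries k ψ τ) := by
  -- The rows `c` and `-c` are folded together by `d ↦ -d`; this leaves `c > 0` and forces the
  -- parity of `φ`. The row `c = 0` is the constant term.
  let ψ' : ZMod N → ZMod N → ℂ := fun x y => ψ ![x, y] + (-1) ^ k * ψ ![-x, -y]
  have hψ' (x y) : ψ' (-x) (-y) = (-1) ^ k * ψ' x y := by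
    simp only [ψ', neg_neg, mul_add, ← mul_assoc, ← pow_add, ← two_mul, pow_mul]
    norm_num
    ring
  let φ : ZMod N → ZMod N → ℂ := fun x y => (-2 * π * I) ^ k / ((k - 1).factorial : ℂ) * ((N : ℂ) ^ k)⁻¹ *
        ∑ j, ψ' x j * stdAddChar (j * y)
  refine ⟨φ, ∑' d : ℤ, ψ ![0, d] * (d : ℂ) ^ (-(k : ℤ)), fun x y => ?_, fun τ => ?_⟩
  · simp only [φ]
    rw [mul_left_comm]
    refine congrArg _ ?_
    rw [Finset.mul_sum]
    refine Fintype.sum_equiv (Equiv.neg (ZMod N)) _ _ fun j => ?_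
    have h := hψ' x (-j)
    rw [neg_neg] at h
    rw [h, Equiv.neg_apply, mul_neg, neg_mul, mul_assoc]
  set q := cexp (2 * π * I * τ / N) with hq
  have hq1 : ‖q‖ < 1 := by
    have := norm_exp_two_pi_I_lt_one ⟨(τ : ℂ) / N, by
      rw [← Complex.ofReal_natCast N, Complex.div_ofReal_im]
      exact div_pos τ.im_pos (by exact_mod_cast NeZero.pos N)⟩
    rwa [hq, mul_div_assoc]
  let F : ℤ × ℤ → ℂ := fun p => ψ ![p.1, p.2] * (p.1 * τ + p.2 : ℂ) ^ (-(k : ℤ))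
  have hF : (fun v : Fin 2 → ℤ => ψ (fun i => (v i : ZMod N)) * eisSummand k v τ) ∘
      (finTwoArrowEquiv ℤ).symm = F := by
    ext p
    simp only [Function.comp_apply, F, eisSummand, finTwoArrowEquiv_symm_apply]
    congr 2
    ext i; fin_cases i <;> rfl
  have hFs : Summable F :=
    hF ▸ (finTwoArrowEquiv ℤ).symm.summable_iff.mpr (summable_norm_lattice hk ψ τ).of_norm
  have e1 : latticeSeries k ψ τ = ∑' c : ℤ, ∑' d : ℤ, F (c, d) := by
    rw [← hFs.tsum_prod, ← hF, latticeSeries, ← (finTwoArrowEquiv ℤ).symm.tsum_eq]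
    rfl
  have e2 (c : ℕ+) : ∑' d : ℤ, F ((c : ℕ), d) + ∑' d : ℤ, F (-(c : ℕ), d) =
      ∑' m : ℕ+, φ c m * (m : ℂ) ^ (k - 1) * q ^ (c * m : ℕ) := by
    have h := tsum_periodic_mul_zpow (ψ' c) (k := k) (by omega) ⟨(c : ℕ) * (τ : ℂ), by
      simpa using τ.2⟩
    have h2 (m : ℕ+) : q ^ (c * m : ℕ) = cexp (2 * π * I * (c * (τ : ℂ)) / N) ^ (m : ℕ) := by
      rw [pow_mul, hq, ← Complex.exp_nat_mul]
      congr 2; ring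
    simp_rw [h2]
    refine Eq.trans ?_ h
    have h3 : ∑' d : ℤ, F (-(c : ℕ), d) = ∑' d : ℤ, F (-(c : ℕ), -d) :=
      ((Equiv.neg ℤ).tsum_eq (fun d => F (-(c : ℕ), d))).symm
    rw [h3, ← Summable.tsum_add]
    · refine tsum_congr fun d => ?_
      simp only [F, ψ', Int.cast_natCast, Int.cast_neg]
      rw [show (-((c : ℕ) : ℂ) * τ + -(d : ℂ)) = (-1) * ((c : ℕ) * τ + d) by ring, mul_zpow,
        zpow_neg, zpow_neg, zpow_natCast, zpow_natCast, ← inv_pow, ← inv_pow,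
        show (-1 : ℂ)⁻¹ = -1 by norm_num]
      ring
    · exact hFs.prod_factor _
    · exact (Equiv.neg ℤ).summable_iff.mpr (hFs.prod_factor (-(c : ℕ) : ℤ))
  have hsum : Summable fun p : ℕ+ × ℕ+ => φ p.1 p.2 * (p.2 : ℂ) ^ (k - 1) * q ^ (p.1 * p.2 : ℕ) := by
    refine Summable.of_norm_bounded ((summable_prod_mul_pow (k - 1) hq1).norm.mul_left
      (∑ x : ZMod N × ZMod N, ‖φ x.1 x.2‖)) fun p => ?_
    rw [mul_assoc, norm_mul]
    exact mul_le_mul_of_nonneg_right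
      (norm_apply_le_sum (fun x : ZMod N × ZMod N => φ x.1 x.2) (p.1, p.2)) (norm_nonneg _)
  have e3 : latticeSeries k ψ τ = ∑' d : ℤ, ψ ![0, d] * (d : ℂ) ^ (-(k : ℤ)) +
      ∑' p : ℕ+ × ℕ+, φ p.1 p.2 * (p.2 : ℂ) ^ (k - 1) * q ^ (p.1 * p.2 : ℕ) := by
    have hFp : Summable fun c : ℤ => ∑' d : ℤ, F (c, d) := hFs.prod
    have s1 : Summable fun c : ℕ+ => ∑' d : ℤ, F ((c : ℕ), d) :=
      hFp.comp_injective (i := fun c : ℕ+ => ((c : ℕ) : ℤ))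
        (fun a b h => by simpa using h)
    have s2 : Summable fun c : ℕ+ => ∑' d : ℤ, F (-(c : ℕ), d) :=
      hFp.comp_injective (i := fun c : ℕ+ => (-(c : ℕ) : ℤ))
        (fun a b h => by simpa using h)
    rw [e1, tsum_int_eq_zero_add_tsum_pnat hFp, add_assoc, ← s1.tsum_add s2, hsum.tsum_prod]
    simp_rw [e2]
    congr 1
    simp [F]
  have e4 := (sigmaAntidiagonalEquivProd.hasSum_iff.mpr hsum.hasSum).sigma
    (fun n => hasSum_fintype _)
  have e5 : HasSum (fun n : ℕ+ => (∑ p ∈ (n : ℕ).divisorsAntidiagonal,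
      φ p.1 p.2 * (p.2 : ℂ) ^ (k - 1)) * q ^ (n : ℕ))
      (∑' p : ℕ+ × ℕ+, φ p.1 p.2 * (p.2 : ℂ) ^ (k - 1) * q ^ (p.1 * p.2 : ℕ)) := by
    refine e4.congr_fun fun n => ?_
    rw [Finset.sum_mul, ← Finset.sum_attach]
    refine Finset.sum_congr rfl fun p _ => ?_
    have := (Nat.mem_divisorsAntidiagonal.mp p.2).1
    simp only [Function.comp_apply, sigmaAntidiagonalEquivProd, divisorsAntidiagonalFactors,
      Equiv.coe_fn_mk, PNat.mk_coe]
    rw [this]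
  have e6 := (hasSum_pnat_iff (f := fun n : ℕ => (if n = 0 then
    ∑' d : ℤ, ψ ![0, d] * (d : ℂ) ^ (-(k : ℤ)) else
    ∑ p ∈ n.divisorsAntidiagonal, φ p.1 p.2 * (p.2 : ℂ) ^ (k - 1)) * q ^ n)).mp
    (e5.congr_fun fun n => by simp)
  rw [e3, add_comm]
  simpa using e6

lemma IsEisenstein.exists_hasSum {N k : ℕ} [NeZero N] (hk : 3 ≤ k) {f : ℍ → ℂ}
    (hf : IsEisenstein N k f) :
    ∃ (φ : ZMod N → ZMod N → ℂ) (a₀ : ℂ), (∀ x y, φ (-x) (-y) = (-1) ^ k * φ x y) ∧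
      ∀ τ : ℍ, HasSum (fun n : ℕ => (if n = 0 then a₀ else
        ∑ p ∈ n.divisorsAntidiagonal, φ p.1 p.2 * (p.2 : ℂ) ^ (k - 1)) *
          cexp (2 * π * I * τ / N) ^ n) (f τ) := by
  obtain ⟨ψ, rfl⟩ := hf.exists_latticeSeries hk
  exact exists_hasSum_latticeSeries hk ψ

end

/-! ### Coefficients in `K` and the associated Dirichlet series. -/

noncomputable section

open UpperHalfPlane hiding I
open Complex ZMod

/-- A subspace has a linear complement. The `φ` of the lattice series contains powers of `π` and
roots of unity; composing it with `p` makes it `K`-valued and fixes the coefficients already in `K`.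
-/
lemma exists_linearMap_retraction (K : IntermediateField ℚ ℂ) :
    ∃ p : ℂ →ₗ[K] K, ∀ x : K, p (x : ℂ) = x := by
  obtain ⟨p, hp⟩ := LinearMap.exists_leftInverse_of_injective (Algebra.linearMap K ℂ)
    (LinearMap.ker_eq_bot.mpr (algebraMap K ℂ).injective)
  exact ⟨p, fun x => LinearMap.congr_fun hp x⟩

/-- The coefficients of a `q_h`-expansion, as those of an expansion in `q_{th}`. -/
def spreadCoeff (t : ℕ) (a : ℕ → ℂ) (n : ℕ) : ℂ := if t ∣ n then a (n / t) else 0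

lemma hasSum_spreadCoeff_mul {t : ℕ} (ht : t ≠ 0) {a u : ℕ → ℂ} {S : ℂ} :
    HasSum (fun n => spreadCoeff t a n * u n) S ↔ HasSum (fun n => a n * u (t * n)) S := by
  have hi : Function.Injective (fun n : ℕ => t * n) := fun x y h =>
    Nat.eq_of_mul_eq_mul_left (Nat.pos_of_ne_zero ht) h
  rw [← hi.hasSum_iff]
  · refine iff_of_eq (congrArg (HasSum · S) (funext fun n => ?_))
    simp [spreadCoeff, Nat.pos_of_ne_zero ht]
  · intro n hn
    have : ¬ t ∣ n := fun ⟨c, hc⟩ => hn ⟨c, hc.symm⟩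
    simp [spreadCoeff, this]

variable {K : IntermediateField ℚ ℂ} {Γ : Subgroup SL(2, ℤ)} [Γ.FiniteIndex] {N k : ℕ} [NeZero N]

/-- An Eisenstein series with coefficients in `K` has coefficients
`∑_{xy=n} φ(x,y) y^(k-1)` with `φ` periodic and `K`-valued. -/
lemma exists_periodic_coeff (hk : 3 ≤ k) {t : ℕ}
    (ht : (N : ℝ) = t * (Γ : Subgroup (GL (Fin 2) ℝ)).strictWidthInfty)
    (f : ModularForm (Γ : Subgroup (GL (Fin 2) ℝ)) k) (hE : IsEisenstein N k f)
    (hc : HasCoeffsIn K Γ f) :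
    ∃ φ : ZMod N → ZMod N → ℂ, (∀ x y, φ x y ∈ K) ∧
      (∀ x y, φ (-x) (-y) = (-1) ^ k * φ x y) ∧
      ∀ n ≠ 0, spreadCoeff t (fun n => (qExpansion
        (Γ : Subgroup (GL (Fin 2) ℝ)).strictWidthInfty f).coeff n) n =
          ∑ p ∈ n.divisorsAntidiagonal, φ p.1 p.2 * (p.2 : ℂ) ^ (k - 1) := by
  obtain ⟨φ, a₀, hφ, hsum⟩ := hE.exists_hasSum hk
  set h := (Γ : Subgroup (GL (Fin 2) ℝ)).strictWidthInfty with hh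
  have hN : (0 : ℝ) < N := by exact_mod_cast NeZero.pos N
  have ht0 : t ≠ 0 := by rintro rfl; simp [NeZero.ne N] at ht
  have hpos : 0 < h := by
    by_contra hneg
    have := mul_nonpos_of_nonneg_of_nonpos (Nat.cast_nonneg (α := ℝ) t) (not_lt.mp hneg)
    linarith
  have hmem : h ∈ (Γ : Subgroup (GL (Fin 2) ℝ)).strictPeriods :=
    Subgroup.strictWidthInfty_mem_strictPeriods _
  have hmemN : (N : ℝ) ∈ (Γ : Subgroup (GL (Fin 2) ℝ)).strictPeriods := by
    rw [ht, ← nsmul_eq_mul]; exact nsmul_mem hmem t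
  -- The expansion at the true width is rewritten in the parameter of width `N`, where uniqueness of
  -- coefficients allows comparison with the lattice expansion.
  have hb (τ : ℍ) : HasSum (fun n => spreadCoeff t (fun n => (qExpansion h f).coeff n) n •
      Function.Periodic.qParam N τ ^ n) (f τ) := by
    simp only [smul_eq_mul]
    rw [hasSum_spreadCoeff_mul ht0]
    refine (ModularForm.hasSum_qExpansion f hpos hmem τ).congr_fun fun n => ?_
    rw [pow_mul]
    congr 2
    rw [Function.Periodic.qParam, Function.Periodic.qParam, ← Complex.exp_nat_mul, ht]
    congr 1
    have h1 : (t : ℂ) ≠ 0 := by exact_mod_cast ht0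
    have h2 : (h : ℂ) ≠ 0 := by exact_mod_cast hpos.ne'
    push_cast
    field_simp
  have hcoef (n : ℕ) : spreadCoeff t (fun n => (qExpansion h f).coeff n) n =
      if n = 0 then a₀ else
        ∑ p ∈ n.divisorsAntidiagonal, φ p.1 p.2 * (p.2 : ℂ) ^ (k - 1) := by
    rw [ModularFormClass.qExpansion_coeff_unique hN hmemN hb n]
    refine (ModularFormClass.qExpansion_coeff_unique (c := fun n => if n = 0 then a₀ else
        ∑ p ∈ n.divisorsAntidiagonal, φ p.1 p.2 * (p.2 : ℂ) ^ (k - 1)) hN hmemN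
        (f := f) (fun τ => ?_) n).symm
    refine (hsum τ).congr_fun fun n => ?_
    simp [Function.Periodic.qParam]
  obtain ⟨p, hp⟩ := exists_linearMap_retraction K
  refine ⟨fun x y => (p (φ x y) : ℂ), fun x y => (p (φ x y)).2, fun x y => ?_, fun n hn => ?_⟩
  · simp only [hφ]
    rcases neg_one_pow_eq_or ℂ k with h | h <;> simp [h]
  · have hK : spreadCoeff t (fun n => (qExpansion h f).coeff n) n ∈ K := by
      unfold spreadCoeff
      split_ifs
      · exact hc _
      · exact K.zero_mem
    have h1 := hp ⟨_, hK⟩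
    have h2 : spreadCoeff t (fun n => (qExpansion h f).coeff n) n =
        (p (spreadCoeff t (fun n => (qExpansion h f).coeff n) n) : ℂ) := by rw [h1]
    rw [h2, hcoef, if_neg hn, map_sum, AddSubmonoidClass.coe_finsetSum]
    refine Finset.sum_congr rfl fun q _ => ?_
    -- Only additivity of `p` is needed here, because the factor `y^(k-1)` is a natural number.
    have h3 (z : ℂ) : z * (q.2 : ℂ) ^ (k - 1) = (q.2 ^ (k - 1)) • z := by
      rw [nsmul_eq_mul]; push_cast; ring
    rw [h3, h3, map_nsmul]
    simp

lemma LSeriesHasSum_mul_pow {a : ℕ → ℂ} {s S : ℂ} (j : ℕ)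
    (h : LSeriesHasSum a (s - j) S) : LSeriesHasSum (fun n => a n * (n : ℂ) ^ j) s S := by
  refine HasSum.congr_fun h fun n => ?_
  rcases eq_or_ne n 0 with rfl | hn
  · simp
  · have hn' : (n : ℂ) ≠ 0 := by exact_mod_cast hn
    rw [LSeries.term_of_ne_zero hn, LSeries.term_of_ne_zero hn, cpow_sub _ _ hn', cpow_natCast]
    field_simp

lemma LSeriesHasSum_LFunction (Φ : ZMod N → ℂ) {s : ℂ} (hs : 1 < s.re) :
    LSeriesHasSum (fun n => Φ n) s (LFunction Φ s) := by
  rw [LFunction_eq_LSeries Φ hs]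
  exact (LSeriesSummable_of_one_lt_re Φ hs).LSeriesHasSum

/-- The Dirichlet series of an Eisenstein series, continued: a sum of products of `L`-functions. -/
def bilinearL (k : ℕ) (φ : ZMod N → ZMod N → ℂ) (s : ℂ) : ℂ :=
  ∑ x, ∑ y, φ x y * (LFunction (Pi.single x 1) s * LFunction (Pi.single y 1) (s - (k - 1 : ℕ)))

/-- Expanding `φ` in products of indicator functions makes the divisor sum a combination of
Dirichlet convolutions. -/
lemma LSeriesHasSum_bilinearL (φ : ZMod N → ZMod N → ℂ) {s : ℂ} (hs : k + 1 < s.re) :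
    LSeriesHasSum (fun n => ∑ p ∈ n.divisorsAntidiagonal, φ p.1 p.2 * (p.2 : ℂ) ^ (k - 1)) s
      (bilinearL k φ s) := by
  have h1 : 1 < s.re := by linarith [Nat.cast_nonneg (α := ℝ) k]
  have h2 : 1 < (s - (k - 1 : ℕ)).re := by
    have : ((k - 1 : ℕ) : ℝ) ≤ k := by exact_mod_cast Nat.sub_le k 1
    rw [sub_re, natCast_re]; linarith
  have h3 (x y : ZMod N) := (LSeriesHasSum_LFunction (Pi.single x 1) h1).convolution
    (LSeriesHasSum_mul_pow (k - 1) (LSeriesHasSum_LFunction (Pi.single y 1) h2))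
  have h4 := hasSum_sum (s := Finset.univ) fun x _ => hasSum_sum (s := Finset.univ) fun y _ =>
    (h3 x y).mul_left (φ x y)
  refine HasSum.congr_fun h4 fun n => ?_
  rcases eq_or_ne n 0 with rfl | hn
  · simp
  simp only [LSeries.term_of_ne_zero hn, LSeries.convolution_def, mul_div_assoc']
  simp only [← Finset.sum_div, Finset.mul_sum]
  congr 1
  rw [Finset.sum_congr rfl fun x _ => Finset.sum_comm, Finset.sum_comm]
  refine Finset.sum_congr rfl fun p _ => ?_
  rw [Finset.sum_eq_single (p.1 : ZMod N), Finset.sum_eq_single (p.2 : ZMod N)]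
  · simp
  · intro y _ hy; simp [hy.symm]
  · simp
  · intro x _ hx; simp [Pi.single_apply, hx.symm]
  · simp

/-- The factor `N^(-s) = t^(-s) h^(-s)` accounts for the normalisation of `ModularForm.L` by the
width `h` and for the change of parameter to width `N = t h`. -/
lemma cpow_mul_L_eq_bilinearL (hk0 : 0 < (k : ℤ)) {t : ℕ}
    (ht : (N : ℝ) = t * (Γ : Subgroup (GL (Fin 2) ℝ)).strictWidthInfty)
    (f : ModularForm (Γ : Subgroup (GL (Fin 2) ℝ)) k) {φ : ZMod N → ZMod N → ℂ}
    (hφ : ∀ n ≠ 0, spreadCoeff t (fun n => (qExpansion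
        (Γ : Subgroup (GL (Fin 2) ℝ)).strictWidthInfty f).coeff n) n =
          ∑ p ∈ n.divisorsAntidiagonal, φ p.1 p.2 * (p.2 : ℂ) ^ (k - 1))
    {s : ℂ} (hs : k + 1 < s.re) :
    (N : ℂ) ^ (-s) * ModularForm.L hk0 f s = bilinearL k φ s := by
  set h := (Γ : Subgroup (GL (Fin 2) ℝ)).strictWidthInfty with hh
  have ht0 : t ≠ 0 := by rintro rfl; simp [NeZero.ne N] at ht
  have hs0 : s ≠ 0 := by
    rintro rfl
    have := Nat.cast_nonneg (α := ℝ) k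
    simp at hs; linarith
  have h1 := (ModularForm.hasSum_L hk0 f (s := s) (by exact_mod_cast hs)).mul_left ((t : ℂ) ^ (-s))
  have h2 : HasSum (fun n : ℕ => spreadCoeff t (fun n => (qExpansion h f).coeff n) n *
      ((n : ℂ) ^ s)⁻¹) ((N : ℂ) ^ (-s) * ModularForm.L hk0 f s) := by
    rw [hasSum_spreadCoeff_mul ht0]
    have hN : (N : ℂ) ^ (-s) = (t : ℂ) ^ (-s) * (h : ℂ) ^ (-s) := by
      rw [← ofReal_natCast N, ht, ofReal_mul, mul_cpow_ofReal_nonneg (Nat.cast_nonneg t)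
        (Subgroup.strictWidthInfty_nonneg _), ofReal_natCast]
    rw [hN, mul_assoc]
    refine h1.congr_fun fun n => ?_
    rw [Nat.cast_mul, natCast_mul_natCast_cpow, cpow_neg, mul_inv]
    ring
  refine h2.unique (HasSum.congr_fun (LSeriesHasSum_bilinearL φ hs) fun n => ?_)
  rcases eq_or_ne n 0 with rfl | hn
  · simp [hs0]
  · rw [LSeries.term_of_ne_zero hn, hφ n hn, div_eq_mul_inv]

lemma differentiableAt_bilinearL (φ : ZMod N → ZMod N → ℂ) {s : ℂ} (h1 : s ≠ 1)
    (h2 : s - (k - 1 : ℕ) ≠ 1) : DifferentiableAt ℂ (bilinearL k φ) s := by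
  unfold bilinearL
  refine .fun_sum fun x _ => .fun_sum fun y _ => .const_mul (.mul ?_ ?_) _
  · exact differentiableAt_LFunction _ _ (.inl h1)
  · exact (differentiableAt_LFunction (Pi.single y 1) (s - (k - 1 : ℕ)) (.inl h2)).comp
      (f := fun s : ℂ => s - (k - 1 : ℕ)) s (by fun_prop)

/-- The two constant terms, the only source of poles of `Λ`, are the values of `f` and of `f ∣ S` at
`∞`; the cusp `0` is `S ∞`. -/
lemma isStrongFEPair_of_isZeroAt (hk0 : 0 < (k : ℤ))
    (f : ModularForm (Γ : Subgroup (GL (Fin 2) ℝ)) k)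
    (h0 : OnePoint.IsZeroAt ((0 : ℝ) : OnePoint ℝ) f k)
    (hinf : OnePoint.IsZeroAt OnePoint.infty f k) :
    IsStrongFEPair (ModularForm.weakFEPair hk0 f) where
  hf₀ := (OnePoint.isZeroAt_infty_iff.mp hinf).valueAtInfty_eq_zero
  hg₀ := by
    refine IsZeroAtImInfty.valueAtInfty_eq_zero ?_
    exact h0 ModularGroup.S (by
      rw [OnePoint.smul_infty_eq_ite]
      simp [ModularGroup.coe_S])

lemma differentiable_L_of_isZeroAt (hk0 : 0 < (k : ℤ))
    (f : ModularForm (Γ : Subgroup (GL (Fin 2) ℝ)) k)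
    (h0 : OnePoint.IsZeroAt ((0 : ℝ) : OnePoint ℝ) f k)
    (hinf : OnePoint.IsZeroAt OnePoint.infty f k) :
    Differentiable ℂ (ModularForm.L hk0 f) := by
  have := (isStrongFEPair_of_isZeroAt hk0 f h0 hinf).differentiable_Λ
  have h : Differentiable ℂ (ModularForm.Λ hk0 f) := this
  unfold ModularForm.L
  simp only [div_eq_mul_inv]
  fun_prop

/-- The values of `L(f, s)` in terms of `L`-functions of periodic functions. -/
lemma exists_bilinearL_eq (hk : 3 ≤ k) (hk0 : 0 < (k : ℤ)) {t : ℕ}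
    (ht : (N : ℝ) = t * (Γ : Subgroup (GL (Fin 2) ℝ)).strictWidthInfty)
    {f : ModularForm (Γ : Subgroup (GL (Fin 2) ℝ)) k} (hf : f ∈ eisensteinZeroInfty K Γ N k) :
    ∃ φ : ZMod N → ZMod N → ℂ, (∀ x y, φ x y ∈ K) ∧
      (∀ x y, φ (-x) (-y) = (-1) ^ k * φ x y) ∧
      ∀ s : ℂ, s ≠ 1 → s ≠ k → (N : ℂ) ^ (-s) * ModularForm.L hk0 f s = bilinearL k φ s := by
  obtain ⟨hE, h0, hinf, hc⟩ := hf
  obtain ⟨φ, hK, hpar, hφ⟩ := exists_periodic_coeff hk ht f hE hc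
  refine ⟨φ, hK, hpar, fun s hs1 hsk => ?_⟩
  have hkk : ((k - 1 : ℕ) : ℂ) = k - 1 := by rw [Nat.cast_sub (by omega)]; simp
  have hL := differentiable_L_of_isZeroAt hk0 f h0 hinf
  -- Both sides are analytic off the possible poles `1` and `k`; removing two points leaves the
  -- plane connected, so agreement near `k + 2` propagates.
  let U : Set ℂ := {1, (k : ℂ)}ᶜ
  have hUo : IsOpen U := (Set.toFinite {1, (k : ℂ)}).isClosed.isOpen_compl
  have hUc : IsPreconnected U := ((Set.toFinite {1, (k : ℂ)}).countable.isConnected_compl_of_one_lt_rank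
    (by simp [rank_real_complex])).isPreconnected
  have hF : AnalyticOnNhd ℂ (fun s => (N : ℂ) ^ (-s) * ModularForm.L hk0 f s) U := by
    refine DifferentiableOn.analyticOnNhd (Differentiable.differentiableOn ?_) hUo
    have : (N : ℂ) ≠ 0 := NeZero.ne _
    fun_prop (disch := simp [this])
  have hG : AnalyticOnNhd ℂ (bilinearL k φ) U := by
    refine DifferentiableOn.analyticOnNhd (fun s hs => ?_) hUo
    have h1 : s ≠ 1 ∧ s ≠ k := by simpa [U] using hs
    refine (differentiableAt_bilinearL φ h1.1 ?_).differentiableWithinAt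
    rw [hkk]
    intro h
    exact h1.2 (by linear_combination h)
  have hV : {s : ℂ | (k : ℝ) + 1 < s.re} ∈ nhds ((k : ℂ) + 2) :=
    (isOpen_lt continuous_const Complex.continuous_re).mem_nhds (by simp)
  have hmem : ((k : ℂ) + 2) ∈ U := by
    simp only [U, Set.mem_compl_iff, Set.mem_insert_iff, Set.mem_singleton_iff, not_or]
    constructor
    · intro h
      have := congrArg Complex.re h
      simp at this
      linarith [Nat.cast_nonneg (α := ℝ) k]
    · intro h
      have := congrArg Complex.re h
      simp at this
  refine hF.eqOn_of_preconnected_of_eventuallyEq hG hUc hmem ?_ (by simp [U, hs1, hsk])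
  filter_upwards [hV] with s hs
  exact cpow_mul_L_eq_bilinearL hk0 ht f hφ hs

end

/-! ### The odd Hurwitz zeta function at `1`. -/

noncomputable section

open UpperHalfPlane hiding I
open Complex ZMod Filter Topology HurwitzZeta

/-- A majorant uniform in `s ∈ [1,2]`, summable once `M = n + 1`; it permits the termwise limit `s →
1⁺`. One factor `1/M` comes from `b^(-s)`, the other from `1 - (b/a)^s`. -/
lemma one_div_rpow_sub_le {a b c M s : ℝ} (hc : 0 < c) (hM : 1 ≤ M) (hb : c * M ≤ b) (hba : b ≤ a)
    (hab : a - b ≤ 1) (hs1 : 1 ≤ s) (hs2 : s ≤ 2) :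
    |1 / b ^ s - 1 / a ^ s| ≤ (2 / c ^ 2 + 2 / c ^ 3) * (1 / M ^ 2) := by
  have hM0 : 0 < M := by linarith
  have hb0 : 0 < b := lt_of_lt_of_le (by positivity) hb
  have ha0 : 0 < a := hb0.trans_le hba
  have hbs : 0 < b ^ s := Real.rpow_pos_of_pos hb0 s
  have has : 0 < a ^ s := Real.rpow_pos_of_pos ha0 s
  have hle : b ^ s ≤ a ^ s := Real.rpow_le_rpow hb0.le hba (by linarith)
  rw [abs_of_nonneg (sub_nonneg.mpr (one_div_le_one_div_of_le hbs hle))]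
  have h1 : 1 / b ^ s - 1 / a ^ s = 1 / b ^ s * (1 - (b / a) ^ s) := by
    rw [Real.div_rpow hb0.le ha0.le]; field_simp
  have h2 : 1 - (b / a) ^ s ≤ 2 / a := by
    have hq : (b / a) ^ (2 : ℝ) ≤ (b / a) ^ s :=
      Real.rpow_le_rpow_of_exponent_ge (by positivity) ((div_le_one ha0).mpr hba) hs2
    rw [Real.rpow_two] at hq
    have : 1 - (b / a) ^ 2 ≤ 2 * (1 - b / a) := by nlinarith [sq_nonneg (1 - b / a)]
    have h3 : 1 - b / a ≤ 1 / a := by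
      rw [one_sub_div ha0.ne']; gcongr
    calc 1 - (b / a) ^ s ≤ 2 * (1 / a) := by linarith
      _ = 2 / a := by ring
  have h3 : 1 / b ^ s ≤ 1 / b + 1 / b ^ 2 := by
    rcases le_total 1 b with h | h
    · have : b ^ (1 : ℝ) ≤ b ^ s := Real.rpow_le_rpow_of_exponent_le h hs1
      rw [Real.rpow_one] at this
      exact (one_div_le_one_div_of_le hb0 this).trans (by simp; positivity)
    · have : b ^ (2 : ℝ) ≤ b ^ s := Real.rpow_le_rpow_of_exponent_ge hb0 h hs2
      rw [Real.rpow_two] at this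
      exact (one_div_le_one_div_of_le (by positivity) this).trans (by simp; positivity)
  have hcb : c ≤ b := by nlinarith
  calc 1 / b ^ s - 1 / a ^ s ≤ (1 / b + 1 / b ^ 2) * (2 / a) := by
        rw [h1]
        have : 0 ≤ 1 - (b / a) ^ s :=
          sub_nonneg.mpr (Real.rpow_le_one (by positivity) ((div_le_one ha0).mpr hba) (by linarith))
        gcongr
    _ ≤ (1 / b + 1 / b ^ 2) * (2 / b) := by gcongr
    _ = 2 * (1 / b ^ 2) + 2 * (1 / (b ^ 2 * b)) := by field_simp
    _ ≤ 2 * (1 / (c * M) ^ 2) + 2 * (1 / ((c * M) ^ 2 * c)) := by gcongr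
    _ = _ := by field_simp

/-- The value of the odd Hurwitz zeta function at `1`, i.e. the Mittag-Leffler expansion of `cot`. -/
lemma hurwitzZetaOdd_one {x : ℝ} (hx : x ∈ Set.Ioo 0 1) :
    hurwitzZetaOdd (x : UnitAddCircle) 1 = π / 2 * cot (π * x) := by
  obtain ⟨hx0, hx1⟩ := hx
  have h1x : 0 < 1 - x := by linarith
  let F (s : ℝ) (n : ℕ) : ℝ := (1 / ((n + x) ^ s) - 1 / ((n + (1 - x)) ^ s)) / 2
  -- This is at most both `x` and `1 - x`, so `n + x` and `n + (1 - x)` are at least `c (n + 1)`.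
  set c := x * (1 - x) with hc
  have hc0 : 0 < c := by positivity
  let bound (n : ℕ) : ℝ := (2 / c ^ 2 + 2 / c ^ 3) * (1 / ((n : ℝ) + 1) ^ 2)
  have hmono {s : ℝ} (hs1 : 1 ≤ s) (hs2 : s ≤ 2) (n : ℕ) : ‖F s n‖ ≤ bound n := by
    have hn : (0 : ℝ) ≤ n := n.cast_nonneg
    have hcx : c ≤ x := by nlinarith
    have hcy : c ≤ 1 - x := by nlinarith
    have hcn : c * n ≤ n := mul_le_of_le_one_left hn (by linarith)
    have hu : c * (n + 1) ≤ n + x := by linarith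
    have hv : c * (n + 1) ≤ n + (1 - x) := by linarith
    have key : |1 / ((n + x) ^ s) - 1 / ((n + (1 - x)) ^ s)| ≤ bound n := by
      rcases le_total x (1 - x) with h | h
      · exact one_div_rpow_sub_le hc0 (by linarith) hu (by linarith) (by linarith) hs1 hs2
      · rw [abs_sub_comm]
        exact one_div_rpow_sub_le hc0 (by linarith) hv (by linarith) (by linarith) hs1 hs2
    have h2 : ‖F s n‖ = |1 / ((n + x) ^ s) - 1 / ((n + (1 - x)) ^ s)| / 2 := by
      simp [F]
    rw [h2]
    linarith [abs_nonneg (1 / ((n + x) ^ s) - 1 / ((n + (1 - x)) ^ s))]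
  have hbs : Summable bound := by
    refine Summable.mul_left _ ?_
    have := (summable_nat_add_iff 1).mpr (Real.summable_one_div_nat_pow.mpr one_lt_two)
    simpa using this
  have hlim : Tendsto (fun s : ℝ => ∑' n, F s n) (𝓝[>] 1) (𝓝 (∑' n, F 1 n)) := by
    refine tendsto_tsum_of_dominated_convergence (bound := bound) hbs (fun n => ?_) ?_
    · have h1 : (0 : ℝ) < n + x := by positivity
      have h2 : (0 : ℝ) < n + (1 - x) := by positivity
      have : ContinuousAt (fun s => F s n) 1 := by
        simp only [F]
        exact ((continuousAt_const.div (Real.continuousAt_const_rpow h1.ne')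
          (Real.rpow_pos_of_pos h1 1).ne').sub
          (continuousAt_const.div (Real.continuousAt_const_rpow h2.ne')
          (Real.rpow_pos_of_pos h2 1).ne')).div_const 2
      exact this.tendsto.mono_left nhdsWithin_le_nhds
    · filter_upwards [Ioo_mem_nhdsGT one_lt_two] with s hs n using hmono hs.1.le hs.2.le n
  have hL : Tendsto (fun s : ℝ => hurwitzZetaOdd (x : UnitAddCircle) (s : ℂ)) (𝓝[>] 1)
      (𝓝 (hurwitzZetaOdd (x : UnitAddCircle) 1)) := by
    have h := ((differentiable_hurwitzZetaOdd (x : UnitAddCircle)).continuous.comp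
      Complex.continuous_ofReal).tendsto 1
    simp only [Function.comp_def, ofReal_one] at h
    exact h.mono_left nhdsWithin_le_nhds
  have hlim' := (Complex.continuous_ofReal.tendsto _).comp hlim
  have h1 : hurwitzZetaOdd (x : UnitAddCircle) 1 = ((∑' n, F 1 n : ℝ) : ℂ) := by
    refine tendsto_nhds_unique hL (hlim'.congr' ?_)
    filter_upwards [self_mem_nhdsWithin] with s hs
    have h := hasSum_nat_hurwitzZetaOdd_of_mem_Icc (a := x) ⟨hx0.le, hx1.le⟩ (s := s) (by simpa using hs)
    rw [← h.tsum_eq, Function.comp_apply, ofReal_tsum]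
    refine tsum_congr fun n => ?_
    have h1 : (0 : ℝ) ≤ n + x := by positivity
    have h2 : (0 : ℝ) ≤ n + (1 - x) := by positivity
    simp only [F]
    push_cast
    rw [ofReal_cpow h1, ofReal_cpow h2]
    push_cast
    ring_nf
  have hsum : HasSum (fun n => ((F 1 n : ℝ) : ℂ)) ((∑' n, F 1 n : ℝ) : ℂ) := by
    have : Summable (F 1) := Summable.of_norm_bounded hbs (hmono le_rfl one_le_two)
    exact_mod_cast this.hasSum
  have hxi : (x : ℂ) ∈ Complex.integerComplement := by
    rintro ⟨m, hm⟩
    have hm' : (m : ℝ) = x := by exact_mod_cast hm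
    have h1 : (0 : ℝ) < m := by linarith
    have h2 : (m : ℝ) < 1 := by linarith
    have h3 : 0 < m := by exact_mod_cast h1
    have h4 : m < 1 := by exact_mod_cast h2
    omega
  have hcot := cot_series_rep' hxi
  have hcsum : Summable fun n : ℕ => (1 / ((x : ℂ) - (n + 1)) + 1 / (x + (n + 1))) :=
    summable_cotTerm hxi
  -- The partial sums are those of the cotangent series with the pairing shifted by one place, hence
  -- the boundary term `1/(M + x)`, which tends to `0`.
  have hpart (M : ℕ) : ∑ n ∈ Finset.range M, ((F 1 n : ℝ) : ℂ) =
      (1 / x + ∑ n ∈ Finset.range M, (1 / ((x : ℂ) - (n + 1)) + 1 / (x + (n + 1)))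
        - 1 / ((M : ℂ) + x)) / 2 := by
    induction M with
    | zero => simp
    | succ M ih =>
      have e1 : (M : ℂ) + (1 - x) = -(x - (M + 1)) := by ring
      rw [Finset.sum_range_succ, Finset.sum_range_succ, ih]
      simp only [F, Real.rpow_one]
      push_cast
      rw [e1, add_comm (x : ℂ) ((M : ℂ) + 1), div_neg]
      ring
  have hl1 := hsum.tendsto_sum_nat
  have hl0 : Tendsto (fun M : ℕ => 1 / ((M : ℂ) + x)) atTop (𝓝 0) := by
    have : Tendsto (fun M : ℕ => ((1 / ((M : ℝ) + x) : ℝ) : ℂ)) atTop (𝓝 ((0 : ℝ) : ℂ)) := by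
      refine (Complex.continuous_ofReal.tendsto 0).comp ?_
      exact tendsto_const_nhds.div_atTop
        (tendsto_atTop_add_const_right _ _ tendsto_natCast_atTop_atTop)
    simpa using this
  have hl2 := (((tendsto_const_nhds (x := 1 / (x : ℂ))).add hcsum.hasSum.tendsto_sum_nat).sub
    hl0).div_const 2
  rw [h1, tendsto_nhds_unique hl1 (hl2.congr fun M => (hpart M).symm), ← hcot]
  ring

end

/-! ### Special values of `L`-functions of periodic functions. -/

noncomputable section

open UpperHalfPlane hiding I
open Complex ZMod Filter Topology HurwitzZeta

variable {K : IntermediateField ℚ ℂ} {N : ℕ} [NeZero N]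

/-- `K` contains the numbers `2 cos (2 π j / N)` and `2 sin (2 π j / N)`. -/
structure ContainsTrig (K : IntermediateField ℚ ℂ) (N : ℕ) [NeZero N] : Prop where
  cos_mem (j : ZMod N) : stdAddChar j + stdAddChar (-j) ∈ K
  sin_mem (j : ZMod N) : I * (stdAddChar j - stdAddChar (-j)) ∈ K

lemma LFunction_const_mul (c : ℂ) (Φ : ZMod N → ℂ) (s : ℂ) :
    LFunction (fun x => c * Φ x) s = c * LFunction Φ s := by
  simp only [LFunction, mul_assoc, ← Finset.mul_sum]
  ring

lemma LFunction_add (Φ Ψ : ZMod N → ℂ) (s : ℂ) :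
    LFunction (fun x => Φ x + Ψ x) s = LFunction Φ s + LFunction Ψ s := by
  simp only [LFunction, add_mul, Finset.sum_add_distrib]
  ring

lemma ContainsTrig.I_pow_mul_mem (hK : ContainsTrig K N) (s : ℕ) (j : ZMod N) :
    I ^ s * (stdAddChar (-j) + (-1) ^ s * stdAddChar j) ∈ K := by
  have h1 (n : ℕ) : (-1 : ℂ) ^ n ∈ K := pow_mem (neg_mem (one_mem K)) n
  obtain ⟨n, rfl | rfl⟩ := s.even_or_odd'
  · rw [pow_mul, I_sq, pow_mul, neg_one_sq, one_pow, one_mul, add_comm]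
    exact mul_mem (h1 n) (hK.cos_mem j)
  · rw [pow_succ, pow_mul, I_sq, pow_succ, pow_mul, neg_one_sq, one_pow, one_mul]
    have := mul_mem (h1 n) (neg_mem (hK.sin_mem j))
    convert this using 1
    ring

/-- Averaging the Fourier sum over `j` and `-j` turns the exponentials into cosines or sines, and `I
^ s` makes these real. -/
lemma ContainsTrig.I_pow_mul_dft_mem (hK : ContainsTrig K N) {s : ℕ} {Φ : ZMod N → ℂ}
    (hΦ : ∀ x, Φ x ∈ K) (hpar : ∀ x, Φ (-x) = (-1) ^ s * Φ x) (x : ZMod N) :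
    I ^ s * 𝓕 Φ x ∈ K := by
  have h1 : 𝓕 Φ x = ∑ j : ZMod N, stdAddChar (j * x) * ((-1) ^ s * Φ j) := by
    rw [dft_apply]
    exact Fintype.sum_equiv (Equiv.neg _) _ _ fun j => by simp [← hpar]
  have h2 : I ^ s * 𝓕 Φ x = 2⁻¹ * ∑ j : ZMod N,
      I ^ s * (stdAddChar (-(j * x)) + (-1) ^ s * stdAddChar (j * x)) * Φ j := by
    have : I ^ s * 𝓕 Φ x = 2⁻¹ * (I ^ s * (𝓕 Φ x + 𝓕 Φ x)) := by ring
    rw [this]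
    nth_rewrite 2 [h1]
    rw [dft_apply, ← Finset.sum_add_distrib, Finset.mul_sum]
    congr 1
    refine Finset.sum_congr rfl fun j _ => ?_
    rw [smul_eq_mul]
    ring
  rw [h2]
  exact mul_mem (inv_mem (natCast_mem K 2))
    (sum_mem fun j _ => mul_mem (hK.I_pow_mul_mem s _) (hΦ j))

lemma dft_neg_of_parity {s : ℕ} {Φ : ZMod N → ℂ} (hpar : ∀ x, Φ (-x) = (-1) ^ s * Φ x)
    (x : ZMod N) : 𝓕 Φ (-x) = (-1) ^ s * 𝓕 Φ x := by
  rw [← congr_fun (dft_comp_neg Φ), funext hpar, dft_const_mul]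

/-- The half-angle formula `cot(θ/2) = sin θ / (1 - cos θ)` with `θ = 2πj/N` avoids trigonometric
numbers of level `2N`. For `j = 0` the junk value of `cot` is `0`. -/
lemma ContainsTrig.cot_mem (hK : ContainsTrig K N) (j : ZMod N) :
    cot (π * ((j.val / N : ℝ) : ℂ)) ∈ K := by
  have hE : cexp (2 * π * I * ((j.val / N : ℝ) : ℂ)) = stdAddChar j := by
    rw [stdAddChar_apply, toCircle_apply]
    push_cast
    congr 1
    ring
  rw [cot_pi_eq_exp_ratio, hE]
  have hinv : (stdAddChar (-j) : ℂ) * stdAddChar j = 1 := by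
    rw [← AddChar.map_add_eq_mul]; simp
  by_cases h : (stdAddChar j : ℂ) = 1
  · simp [h]
  have h0 : (stdAddChar j : ℂ) ≠ 0 := right_ne_zero_of_mul_eq_one hinv
  have h1 : (stdAddChar (-j) : ℂ) = (stdAddChar j : ℂ)⁻¹ := eq_inv_of_mul_eq_one_left hinv
  have hc := hK.cos_mem j
  have hs := hK.sin_mem j
  rw [h1] at hc hs
  set E : ℂ := stdAddChar j
  have hne : 1 - E ≠ 0 := sub_ne_zero.mpr (Ne.symm h)
  have hne2 : E - 1 ≠ 0 := sub_ne_zero.mpr h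
  have : (E + 1) / (I * (1 - E)) = -(I * (E - E⁻¹)) / (2 - (E + E⁻¹)) := by
    have h3 : 2 - (E + E⁻¹) = -((E - 1) ^ 2) / E := by field_simp; ring
    have h4 : E - E⁻¹ = (E - 1) * (E + 1) / E := by field_simp; ring
    rw [h3, h4]
    have : I * (1 - E) ≠ 0 := mul_ne_zero I_ne_zero hne
    field_simp
    rw [I_sq]
    ring
  rw [this]
  exact div_mem (neg_mem hs) (sub_mem (natCast_mem K 2) hc)

lemma exists_LFunction_one_eq (hK : ContainsTrig K N) {Φ : ZMod N → ℂ} (hΦ : ∀ x, Φ x ∈ K)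
    (hpar : Φ.Odd) : ∃ c ∈ K, LFunction Φ 1 = c * π := by
  refine ⟨(N : ℂ)⁻¹ * ∑ j : ZMod N, Φ j * (cot (π * ((j.val / N : ℝ) : ℂ)) / 2),
    mul_mem (inv_mem (natCast_mem K N)) (sum_mem fun j _ => mul_mem (hΦ j)
      (div_mem (hK.cot_mem j) (natCast_mem K 2))), ?_⟩
  rw [LFunction_def_odd hpar, cpow_neg_one, mul_assoc, Finset.sum_mul]
  congr 1
  refine Finset.sum_congr rfl fun j _ => ?_
  rcases eq_or_ne j 0 with rfl | hj
  · have : Φ 0 = 0 := by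
      have := hpar 0
      rw [neg_zero] at this
      linear_combination this / 2
    simp [this]
  have hN : (0 : ℝ) < N := Nat.cast_pos.mpr (NeZero.pos N)
  have hj0 : 0 < j.val := Nat.pos_of_ne_zero ((ZMod.val_ne_zero j).mpr hj)
  rw [toAddCircle_apply, hurwitzZetaOdd_one ⟨by positivity, (div_lt_one hN).mpr
    (Nat.cast_lt.mpr j.val_lt)⟩]
  ring

/-- The functional equation at positive integers of the right parity. -/
lemma LFunction_natCast_eq {s : ℕ} (hs : 1 ≤ s) {Φ : ZMod N → ℂ}
    (hpar : ∀ x, Φ (-x) = (-1) ^ s * Φ x) :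
    LFunction Φ s = (2 * π) ^ s / (2 * N ^ s * (s - 1).factorial) *
      LFunction (fun x => I ^ s * 𝓕 Φ x) (1 - s) := by
  have hN : (N : ℂ) ≠ 0 := NeZero.ne _
  have h2π : (2 * π : ℂ) ≠ 0 := by simp [Real.pi_ne_zero]
  have hΨ := dft_neg_of_parity hpar
  have hs0 : ∀ n : ℕ, (s : ℂ) ≠ -n := fun n h => by
    have := congrArg Complex.re h
    simp only [natCast_re, neg_re] at this
    have h3 : (1 : ℝ) ≤ s := by exact_mod_cast hs
    linarith [Nat.cast_nonneg (α := ℝ) n]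
  -- At `s = 1` the function is odd, so its transform vanishes at `0`.
  have h1 : 𝓕 Φ 0 = 0 ∨ (s : ℂ) ≠ 1 := by
    rcases eq_or_ne s 1 with rfl | h
    · left
      have := hΨ 0
      rw [neg_zero] at this
      linear_combination this / 2
    · right; exact_mod_cast h
  have hfe := LFunction_one_sub (𝓕 Φ) hs0 h1
  have hD : 𝓕 (𝓕 Φ) = fun x => ((N : ℂ) * (-1) ^ s) * Φ x := by
    rw [dft_dft]; funext x; rw [hpar, smul_eq_mul, mul_assoc]
  have hD' : 𝓕 (fun x => 𝓕 Φ (-x)) = fun x => (N : ℂ) * Φ x := by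
    rw [dft_comp_neg, dft_dft]; funext x; simp
  have he1 : cexp (π * I * s / 2) = I ^ s := by
    conv_rhs => rw [← exp_pi_div_two_mul_I, ← Complex.exp_nat_mul]
    congr 1; ring
  have he2 : cexp (-π * I * s / 2) = (-I) ^ s := by
    rw [← exp_neg_pi_div_two_mul_I, ← Complex.exp_nat_mul]; congr 1; ring
  have hG : Gamma (s : ℂ) = (s - 1).factorial := by
    have := Complex.Gamma_nat_eq_factorial (s - 1)
    rw [← this, Nat.cast_sub hs]; simp
  have hNp : (N : ℂ) ^ ((s : ℂ) - 1) = N ^ s / N := by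
    rw [cpow_sub _ _ hN, cpow_natCast, cpow_one]
  have hf : ((s - 1).factorial : ℂ) ≠ 0 := by exact_mod_cast (Nat.factorial_pos _).ne'
  rw [LFunction_const_mul, hfe, hD, hD', LFunction_const_mul, LFunction_const_mul, he1, he2, hG,
    hNp, cpow_neg, cpow_natCast]
  -- For this parity the two exponential terms of the functional equation contribute equally, whence
  -- the factor `2`.
  have hII : I ^ s * I ^ s * (-1) ^ s = 1 := by
    rw [← mul_pow, ← mul_pow]; simp
  have h5 : I ^ s * (I ^ s * (N * (-1) ^ s * LFunction Φ s) + (-I) ^ s * (N * LFunction Φ s))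
      = 2 * N * LFunction Φ s := by
    rw [neg_pow I]
    linear_combination (2 * N * LFunction Φ s) * hII
  have hp : (2 * (π : ℂ)) ^ s ≠ 0 := pow_ne_zero _ h2π
  have hNs : (N : ℂ) ^ s ≠ 0 := pow_ne_zero _ hN
  calc LFunction Φ s = (2 * N * LFunction Φ s) / (2 * N) := by field_simp
    _ = _ := by rw [← h5]; field_simp

/-- Hurwitz zeta values at negative integers are Bernoulli polynomials at the rational points `j/N`,
up to a rational factor. -/
lemma LFunction_neg_natCast_mem {n : ℕ} (hn : n ≠ 0) {Φ : ZMod N → ℂ} (hΦ : ∀ x, Φ x ∈ K) :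
    LFunction Φ (-n) ∈ K := by
  rw [LFunction, neg_neg, cpow_natCast]
  refine mul_mem (pow_mem (natCast_mem K N) n) (sum_mem fun j _ => mul_mem (hΦ j) ?_)
  have hN : (0 : ℝ) < N := Nat.cast_pos.mpr (NeZero.pos N)
  rw [toAddCircle_apply, hurwitzZeta_neg_nat hn ⟨by positivity, (div_le_one hN).mpr
    (Nat.cast_le.mpr j.val_lt.le)⟩]
  have h : ((j.val / N : ℝ) : ℂ) = algebraMap ℚ ℂ (j.val / N) := by
    rw [eq_ratCast]; push_cast; rfl
  rw [h, Polynomial.eval_map_algebraMap, Polynomial.aeval_algebraMap_apply]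
  exact mul_mem (div_mem (neg_mem (one_mem K)) (add_mem (natCast_mem K n) (one_mem K)))
    (K.algebraMap_mem _)

/-- Only the point `0` is not covered by Bernoulli polynomials. There an even function gives `-Φ 0 /
2`; for an odd one the functional equation leads to the transform at `1`, that is, to cotangents. -/
lemma LFunction_one_sub_natCast_mem (hK : ContainsTrig K N) {m : ℕ} (hm : 1 ≤ m)
    {σ : ℕ} {Φ : ZMod N → ℂ} (hΦ : ∀ x, Φ x ∈ K) (hpar : ∀ x, Φ (-x) = (-1) ^ σ * Φ x) :
    LFunction Φ (1 - m) ∈ K := by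
  rcases hm.eq_or_lt with rfl | hm
  · rw [Nat.cast_one, sub_self]
    rcases σ.even_or_odd with hσ | hσ
    · rw [LFunction_apply_zero_of_even (fun x => by simp [hpar, hσ.neg_one_pow])]
      exact div_mem (neg_mem (hΦ 0)) (natCast_mem K 2)
    · have hpar' (x) : Φ (-x) = (-1) ^ 1 * Φ x := by rw [hpar, hσ.neg_one_pow, pow_one]
      let Ψ (x : ZMod N) : ℂ := I ^ 1 * 𝓕 Φ x
      have hΨ (x) : Ψ (-x) = (-1) ^ 1 * Ψ x := by
        simp only [Ψ, dft_neg_of_parity hpar']; ring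
      have h := LFunction_natCast_eq le_rfl hΨ
      obtain ⟨c, hc, hc'⟩ := exists_LFunction_one_eq hK (hK.I_pow_mul_dft_mem hΦ hpar')
        (fun x => by simpa [Ψ] using hΨ x)
      have hD : (fun x => I ^ 1 * 𝓕 Ψ x) = fun x => (N : ℂ) * Φ x := by
        funext x
        simp only [Ψ]
        rw [dft_const_mul, dft_dft]
        simp only [pow_one, hpar', smul_eq_mul]
        linear_combination (-(N : ℂ) * Φ x) * I_sq
      rw [hD, LFunction_const_mul (N : ℂ), Nat.cast_one, hc'] at h
      simp only [pow_one, Nat.sub_self, Nat.factorial_zero, Nat.cast_one, mul_one, sub_self] at h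
      have hN : (N : ℂ) ≠ 0 := NeZero.ne _
      have hp : (π : ℂ) ≠ 0 := by simp [Real.pi_ne_zero]
      have : LFunction Φ 0 = c := by
        field_simp at h
        exact h.symm
      rwa [this]
  · have : (1 : ℂ) - m = -(m - 1 : ℕ) := by
      rw [Nat.cast_sub (by omega)]; simp
    rw [this]
    exact LFunction_neg_natCast_mem (by omega) hΦ

lemma exists_LFunction_natCast_eq (hK : ContainsTrig K N) {s : ℕ} (hs : 1 ≤ s) {Φ : ZMod N → ℂ}
    (hΦ : ∀ x, Φ x ∈ K) (hpar : ∀ x, Φ (-x) = (-1) ^ s * Φ x) :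
    ∃ c ∈ K, LFunction Φ s = c * (2 * π) ^ s := by
  have hpar' (x) : I ^ s * 𝓕 Φ (-x) = (-1) ^ s * (I ^ s * 𝓕 Φ x) := by
    rw [dft_neg_of_parity hpar]; ring
  refine ⟨_, mul_mem (inv_mem (mul_mem (mul_mem (natCast_mem K 2) (pow_mem (natCast_mem K N) s))
    (natCast_mem K (s - 1).factorial)))
    (LFunction_one_sub_natCast_mem hK hs (hK.I_pow_mul_dft_mem hΦ hpar) hpar'), ?_⟩
  rw [LFunction_natCast_eq hs hpar, div_eq_mul_inv]
  push_cast
  ring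

end

/-! ### Products of two `L`-values at the integers `1, …, k-1`. -/

noncomputable section

open UpperHalfPlane hiding I
open Complex ZMod Filter Topology HurwitzZeta

variable {K : IntermediateField ℚ ℂ} {N : ℕ} [NeZero N]

/-- The `K`-span of `π ^ (k - 1)` and of the values at `k - 1` of the `L`-functions of the
`K`-valued functions on `ℤ/N` of parity `(-1) ^ k`. -/
def valueSpan (K : IntermediateField ℚ ℂ) (N : ℕ) [NeZero N] (k : ℕ) : Submodule K ℂ :=
  Submodule.span K ({(π : ℂ) ^ (k - 1)} ∪ {z | ∃ Φ : ZMod N → ℂ, (∀ x, Φ x ∈ K) ∧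
    (∀ x, Φ (-x) = (-1) ^ k * Φ x) ∧ z = LFunction Φ (k - 1 : ℕ)})

lemma mul_pi_pow_mem_valueSpan {k : ℕ} {c : ℂ} (hc : c ∈ K) :
    c * (π : ℂ) ^ (k - 1) ∈ valueSpan K N k :=
  (valueSpan K N k).smul_mem (⟨c, hc⟩ : K) (Submodule.subset_span (.inl rfl))

lemma mul_LFunction_mem_valueSpan {k : ℕ} {c : ℂ} (hc : c ∈ K) {Φ : ZMod N → ℂ}
    (hΦ : ∀ x, Φ x ∈ K) (hpar : ∀ x, Φ (-x) = (-1) ^ k * Φ x) :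
    c * LFunction Φ (k - 1 : ℕ) ∈ valueSpan K N k :=
  (valueSpan K N k).smul_mem (⟨c, hc⟩ : K) (Submodule.subset_span (.inr ⟨Φ, hΦ, hpar, rfl⟩))

/-- The exponential factor of the functional equation vanishes to first order at `k - 1`. -/
lemma tendsto_exp_factor_div (k : ℕ) (hk : 1 ≤ k) :
    Tendsto (fun s : ℂ => (cexp (π * I * (k - s) / 2) + (-1) ^ k * cexp (-π * I * (k - s) / 2)) /
      (s - 1)) (𝓝[≠] 1) (𝓝 (-(π * I ^ k))) := by
  let g (s : ℂ) : ℂ := cexp (π * I * (k - s) / 2) + (-1) ^ k * cexp (-π * I * (k - s) / 2)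
  obtain ⟨j, rfl⟩ : ∃ j, k = j + 1 := ⟨k - 1, by omega⟩
  have he1 : cexp (π * I * ((j + 1 : ℕ) - 1) / 2) = I ^ j := by
    conv_rhs => rw [← exp_pi_div_two_mul_I, ← Complex.exp_nat_mul]
    push_cast
    congr 1; ring
  have he2 : cexp (-π * I * ((j + 1 : ℕ) - 1) / 2) = (-1) ^ j * I ^ j := by
    rw [← neg_pow I, ← exp_neg_pi_div_two_mul_I, ← Complex.exp_nat_mul]
    push_cast
    congr 1; ring
  have h11 : (-1 : ℂ) ^ j * (-1) ^ j = 1 := by rw [← mul_pow]; simp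
  have hg1 : g 1 = 0 := by
    simp only [g, he1, he2]
    linear_combination (-I ^ j) * h11
  have hd : HasDerivAt g (-(π * I ^ (j + 1))) 1 := by
    have hl : HasDerivAt (fun s : ℂ => ((j + 1 : ℕ) : ℂ) - s) (-1) 1 := by
      simpa using (hasDerivAt_id (1 : ℂ)).const_sub ((j + 1 : ℕ) : ℂ)
    have h1 := (((hl.const_mul (π * I : ℂ)).div_const 2).cexp)
    have h2 := (((hl.const_mul (-π * I : ℂ)).div_const 2).cexp).const_mul ((-1 : ℂ) ^ (j + 1))
    refine (h1.add h2).congr_deriv ?_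
    rw [he1, he2]
    linear_combination (-(π * I * I ^ j) / 2) * h11
  have := hd.tendsto_slope
  refine this.congr fun s => ?_
  rw [slope_def_field, hg1, sub_zero]

/-- The case `s = 1`. The functional equation writes `L(B,s-k+1)` as `L(𝓕 B,k-s)` times an
exponential factor with a zero at `1`; this zero cancels the possible pole of `L(A,s)`. -/
lemma exists_tendsto_LFunction_mul_of_even (hK : ContainsTrig K N) {k : ℕ} (hk : 3 ≤ k)
    {A B : ZMod N → ℂ} (hA : ∀ x, A x ∈ K) (hB : ∀ x, B x ∈ K)
    (hBp : ∀ x, B (-x) = (-1) ^ k * B x) :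
    ∃ ℓ : ℂ, Tendsto (fun s => LFunction A s * LFunction B (s - (k - 1 : ℕ))) (𝓝[≠] 1) (𝓝 ℓ) ∧
      (2 * π : ℂ) ^ (k - 1 - 1) * ℓ ∈ valueSpan K N k := by
  have hN : (N : ℂ) ≠ 0 := NeZero.ne _
  have h2π : (2 * π : ℂ) ≠ 0 := by simp [Real.pi_ne_zero]
  have hkk : ((k - 1 : ℕ) : ℂ) = k - 1 := by rw [Nat.cast_sub (by omega)]; simp
  let G (s : ℂ) : ℂ := N ^ ((k - s) - 1) * (2 * π) ^ (-(k - s)) * Gamma (k - s) *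
    LFunction (𝓕 B) (k - s)
  have hre : ∀ᶠ s : ℂ in 𝓝 1, 1 < (k - s).re := by
    have : Continuous fun s : ℂ => ((k : ℂ) - s).re := by fun_prop
    refine this.continuousAt.eventually_const_lt ?_
    have : (3 : ℝ) ≤ k := by exact_mod_cast hk
    simp only [sub_re, natCast_re, one_re]
    linarith
  have hne {s : ℂ} (hs : 1 < ((k : ℂ) - s).re) (n : ℕ) : (k : ℂ) - s ≠ -n := fun h => by
    rw [h] at hs
    simp only [neg_re, natCast_re] at hs
    linarith [Nat.cast_nonneg (α := ℝ) n]
  have hne1 {s : ℂ} (hs : 1 < ((k : ℂ) - s).re) : (k : ℂ) - s ≠ 1 := fun h => by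
    rw [h] at hs; simp at hs
  have hG : ContinuousAt G 1 := by
    have h1 := hre.self_of_nhds
    have hl : ContinuousAt (fun s : ℂ => (k : ℂ) - s) 1 := by fun_prop
    refine ((ContinuousAt.mul ?_ ?_).mul ?_).mul ?_
    · exact (hl.sub continuousAt_const).const_cpow (.inl hN)
    · exact hl.neg.const_cpow (.inl h2π)
    · exact ContinuousAt.comp (g := Gamma)
        (differentiableAt_Gamma _ (hne h1)).continuousAt hl
    · exact ContinuousAt.comp (g := LFunction (𝓕 B))
        (differentiableAt_LFunction _ _ (.inl (hne1 h1))).continuousAt hl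
  have heq : ∀ᶠ s : ℂ in 𝓝[≠] 1, ((s - 1) * LFunction A s) * (G s *
      ((cexp (π * I * (k - s) / 2) + (-1) ^ k * cexp (-π * I * (k - s) / 2)) / (s - 1))) =
      LFunction A s * LFunction B (s - (k - 1 : ℕ)) := by
    filter_upwards [hre.filter_mono nhdsWithin_le_nhds, self_mem_nhdsWithin] with s hs hs1
    have hs1' : s - 1 ≠ 0 := sub_ne_zero.mpr hs1
    have h := LFunction_one_sub B (hne hs) (.inr (hne1 hs))
    rw [funext hBp, dft_const_mul, LFunction_const_mul] at h
    have e : s - (k - 1 : ℕ) = 1 - (k - s) := by rw [hkk]; ring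
    rw [e, h]
    simp only [G]
    field_simp
  have hlim := ((LFunction_residue_one A).mul ((hG.tendsto.mono_left nhdsWithin_le_nhds).mul
    (tendsto_exp_factor_div k (by omega)))).congr' heq
  refine ⟨_, hlim, ?_⟩
  -- All powers of `π` cancel: `(2π)^(k-2)` from the statement, `(2π)^(-(k-1))` from `G`, and one
  -- `π` from the exponential factor.
  have hval : (2 * π : ℂ) ^ (k - 1 - 1) * ((∑ j, A j / N) * (G 1 * -(π * I ^ k))) =
      (-(∑ j, A j / N) * N ^ (k - 2) * (k - 2).factorial / 2) *
        LFunction (fun x => I ^ k * 𝓕 B x) (k - 1 : ℕ) := by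
    obtain ⟨j, rfl⟩ : ∃ j, k = j + 2 := ⟨k - 2, by omega⟩
    have e1 : ((j + 2 : ℕ) : ℂ) - 1 = (j + 1 : ℕ) := by push_cast; ring
    have e2 : ((j + 1 : ℕ) : ℂ) - 1 = (j : ℕ) := by push_cast; ring
    simp only [G]
    rw [LFunction_const_mul, e1, e2, cpow_neg, cpow_natCast, cpow_natCast]
    simp only [Nat.add_sub_cancel, Nat.add_one_sub_one, show j + 2 - 1 = j + 1 by omega]
    rw [show ((j + 1 : ℕ) : ℂ) = (j : ℂ) + 1 by push_cast; ring, Complex.Gamma_nat_eq_factorial]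
    have hp : (π : ℂ) ≠ 0 := by simp [Real.pi_ne_zero]
    rw [pow_succ (2 * (π : ℂ))]
    field_simp
  rw [hval]
  refine mul_LFunction_mem_valueSpan ?_ (hK.I_pow_mul_dft_mem hB hBp) fun x => ?_
  · exact div_mem (mul_mem (mul_mem (neg_mem (sum_mem fun j _ => div_mem (hA j)
      (natCast_mem K N))) (pow_mem (natCast_mem K N) _)) (natCast_mem K _)) (natCast_mem K 2)
  · rw [dft_neg_of_parity hBp]; ring

lemma exists_tendsto_LFunction_mul (hK : ContainsTrig K N) {k : ℕ} (hk : 3 ≤ k) {s : ℕ}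
    (hs1 : 1 ≤ s) (hsk : s ≤ k - 1) {a : ℕ} {A B : ZMod N → ℂ} (hA : ∀ x, A x ∈ K)
    (hB : ∀ x, B x ∈ K) (hAp : ∀ x, A (-x) = (-1) ^ a * A x)
    (hBp : ∀ x, B (-x) = (-1) ^ (a + k) * B x) :
    ∃ ℓ : ℂ, Tendsto (fun z => LFunction A z * LFunction B (z - (k - 1 : ℕ))) (𝓝[≠] (s : ℂ))
      (𝓝 ℓ) ∧ (2 * π : ℂ) ^ (k - 1 - s) * ℓ ∈ valueSpan K N k := by
  have hBs : (s : ℂ) - (k - 1 : ℕ) = 1 - (k - s : ℕ) := by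
    rw [Nat.cast_sub (by omega), Nat.cast_sub (by omega)]; push_cast; ring
  have hBc : ContinuousAt (fun z => LFunction B (z - (k - 1 : ℕ))) (s : ℂ) := by
    refine ContinuousAt.comp (g := LFunction B) (DifferentiableAt.continuousAt
      (differentiableAt_LFunction _ _ (.inl ?_))) (by fun_prop)
    rw [hBs]
    intro h
    have : ((k - s : ℕ) : ℂ) = 0 := by linear_combination -h
    rw [Nat.cast_eq_zero] at this
    omega
  have hprod (hAc : ContinuousAt (LFunction A) s) := (hAc.mul hBc).tendsto.mono_left
    (nhdsWithin_le_nhds (s := {(s : ℂ)}ᶜ))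
  have hne : 2 ≤ s → (s : ℂ) ≠ 1 := fun h h' => by
    have : s = 1 := by exact_mod_cast h'
    omega
  have hAc (h2 : 2 ≤ s) : ContinuousAt (LFunction A) s :=
    (differentiableAt_LFunction _ _ (.inl (hne h2))).continuousAt
  rcases (a + s).even_or_odd with has | has
  · have hAp' (x) : A (-x) = (-1) ^ s * A x := by
      rw [hAp, neg_one_pow_congr (Nat.even_add.mp has)]
    -- At `s = 1` the function `A` is odd, so its sum and hence the residue vanish.
    have hAc' : ContinuousAt (LFunction A) s := by
      rcases hs1.eq_or_lt with rfl | h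
      · refine (differentiableAt_LFunction _ _ (.inr ?_)).continuousAt
        have : ∑ j, A j = -∑ j, A j := by
          rw [← Finset.sum_neg_distrib]
          exact Fintype.sum_equiv (Equiv.neg _) _ _ fun j => by simp [hAp']
        linear_combination this / 2
      · exact hAc h
    refine ⟨_, hprod hAc', ?_⟩
    obtain ⟨c, hc, hc'⟩ := exists_LFunction_natCast_eq hK hs1 hA hAp'
    simp only [Pi.mul_apply]
    rw [hBs, hc']
    have e : (2 * π : ℂ) ^ (k - 1 - s) * (c * (2 * π) ^ s * LFunction B (1 - (k - s : ℕ))) =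
        (c * LFunction B (1 - (k - s : ℕ)) * 2 ^ (k - 1)) * π ^ (k - 1) := by
      have : (2 * π : ℂ) ^ (k - 1 - s) * (2 * π) ^ s = 2 ^ (k - 1) * π ^ (k - 1) := by
        rw [← pow_add, ← mul_pow, Nat.sub_add_cancel hsk]
      linear_combination (c * LFunction B (1 - (k - s : ℕ))) * this
    rw [e]
    exact mul_pi_pow_mem_valueSpan (mul_mem (mul_mem hc
      (LFunction_one_sub_natCast_mem hK (by omega) hB hBp)) (pow_mem (natCast_mem K 2) _))
  · rcases hs1.eq_or_lt with rfl | h2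
    · have ha : Even a := by rcases a.even_or_odd with h | h <;> grind
      refine mod_cast exists_tendsto_LFunction_mul_of_even hK hk hA hB fun x => ?_
      rw [hBp, pow_add, ha.neg_one_pow, one_mul]
    refine ⟨_, hprod (hAc h2), ?_⟩
    simp only [Pi.mul_apply]
    rw [hBs]
    rcases hsk.eq_or_lt with rfl | hlt
    · have hBe : B.Even := fun x => by
        rw [hBp, Even.neg_one_pow (by grind), one_mul]
      rw [show k - (k - 1) = 1 by omega, Nat.cast_one, sub_self, LFunction_apply_zero_of_even hBe,
        Nat.sub_self, pow_zero, one_mul, mul_comm]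
      refine mul_LFunction_mem_valueSpan (div_mem (neg_mem (hB 0)) (natCast_mem K 2)) hA
        fun x => ?_
      rw [hAp, neg_one_pow_congr (m := a) (n := k) (by grind)]
    -- Here `k - s ≥ 2` and `B` has the parity opposite to `k - s`, so this is a trivial zero.
    · have h0 : LFunction B (1 - (k - s : ℕ)) = 0 := by
        rcases (k - s).even_or_odd' with ⟨n, hn | hn⟩
        · have hBo : B.Odd := fun x => by rw [hBp, Odd.neg_one_pow (by grind), neg_one_mul]
          obtain ⟨n, rfl⟩ : ∃ n', n = n' + 1 := ⟨n - 1, by omega⟩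
          rw [hn, ← LFunction_neg_two_mul_nat_sub_one hBo n]
          push_cast
          congr 1; ring
        · have hBe : B.Even := fun x => by
            rw [hBp, Even.neg_one_pow (by grind), one_mul]
          obtain ⟨n, rfl⟩ : ∃ n', n = n' + 1 := ⟨n - 1, by omega⟩
          rw [hn, ← LFunction_neg_two_mul_nat_add_one hBe n]
          push_cast
          congr 1; ring
      rw [h0, mul_zero, mul_zero]
      exact zero_mem _

end

/-! ### Parity decomposition and the general span. -/

noncomputable section

open UpperHalfPlane hiding I
open Complex ZMod Filter Topology

variable {K : IntermediateField ℚ ℂ} {N : ℕ}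

/-- The indicator function of `x`, symmetrized with sign `(-1) ^ a`. -/
def signedSingle (a : ℕ) (x : ZMod N) (z : ZMod N) : ℂ :=
  Pi.single (M := fun _ => ℂ) x 1 z + (-1) ^ a * Pi.single (M := fun _ => ℂ) (-x) 1 z

lemma signedSingle_mem (a : ℕ) (x z : ZMod N) : signedSingle a x z ∈ K := by
  have h (y : ZMod N) : Pi.single (M := fun _ => ℂ) y 1 z ∈ K := by
    rw [Pi.single_apply]; split_ifs
    · exact one_mem K
    · exact zero_mem K
  exact add_mem (h x) (mul_mem (pow_mem (neg_mem (one_mem K)) a) (h (-x)))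

lemma signedSingle_neg (a : ℕ) (x z : ZMod N) :
    signedSingle a x (-z) = (-1) ^ a * signedSingle a x z := by
  have h : (-1 : ℂ) ^ a * (-1) ^ a = 1 := by rw [← mul_pow]; simp
  have e (y : ZMod N) : Pi.single (M := fun _ => ℂ) y 1 (-z) =
      Pi.single (M := fun _ => ℂ) (-y) 1 z := by
    simp only [Pi.single_apply, neg_eq_iff_eq_neg]
  simp only [signedSingle, e, neg_neg]
  linear_combination -Pi.single (M := fun _ => ℂ) (-x) 1 z * h

variable [NeZero N]

lemma LFunction_signedSingle (a : ℕ) (x : ZMod N) (s : ℂ) :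
    LFunction (signedSingle a x) s =
      LFunction (Pi.single x 1) s + (-1) ^ a * LFunction (Pi.single (-x) 1) s := by
  have : signedSingle a x = fun z => Pi.single (M := fun _ => ℂ) x 1 z +
    (-1) ^ a * Pi.single (M := fun _ => ℂ) (-x) 1 z := rfl
  rw [this, LFunction_add, LFunction_const_mul]

/-- Averaging over `(x,y) ↦ (-x,-y)` kills the mixed terms: of the four products of parity
components, only those of parities `a` and `a + k` survive. -/
lemma bilinearL_eq_sum_signedSingle {k : ℕ} {φ : ZMod N → ZMod N → ℂ}
    (hφ : ∀ x y, φ (-x) (-y) = (-1) ^ k * φ x y) (s : ℂ) :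
    bilinearL k φ s = 4⁻¹ * ∑ x, ∑ y, φ x y * ∑ a ∈ Finset.range 2,
      (LFunction (signedSingle a x) s * LFunction (signedSingle (a + k) y) (s - (k - 1 : ℕ))) := by
  set P : ZMod N → ℂ := fun x => LFunction (Pi.single x 1) s with hP
  set Q : ZMod N → ℂ := fun y => LFunction (Pi.single y 1) (s - (k - 1 : ℕ)) with hQ
  have h1 : bilinearL k φ s = ∑ x, ∑ y, (-1) ^ k * φ x y * (P (-x) * Q (-y)) := by
    rw [bilinearL]
    refine Fintype.sum_equiv (Equiv.neg _) _ _ fun x => ?_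
    refine Fintype.sum_equiv (Equiv.neg _) _ _ fun y => ?_
    simp [← hφ, P, Q]
  have h2 : bilinearL k φ s = 2⁻¹ * (bilinearL k φ s + bilinearL k φ s) := by ring
  rw [h2]
  nth_rewrite 2 [h1]
  rw [bilinearL, ← Finset.sum_add_distrib, Finset.mul_sum, Finset.mul_sum]
  refine Finset.sum_congr rfl fun x _ => ?_
  rw [← Finset.sum_add_distrib, Finset.mul_sum, Finset.mul_sum]
  refine Finset.sum_congr rfl fun y _ => ?_
  simp only [Finset.sum_range_succ, Finset.sum_range_zero, LFunction_signedSingle]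
  simp only [← hP, ← hQ, P, Q]
  ring

variable {Γ : Subgroup SL(2, ℤ)} [Γ.FiniteIndex] {k : ℕ}

/-- The factors of `bilinearL` may have a pole at `s = 1`, so the comparison is made through limits
over punctured neighbourhoods; `L(f,s)` itself is continuous. -/
theorem eisensteinLSpan_le_valueSpan (hK : ContainsTrig K N) (hk : 3 ≤ k) (hk0 : 0 < (k : ℤ))
    {t : ℕ} (ht : (N : ℝ) = t * (Γ : Subgroup (GL (Fin 2) ℝ)).strictWidthInfty) :
    eisensteinLSpan K Γ N k hk0 ≤ valueSpan K N k := by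
  refine Submodule.span_le.mpr ?_
  rintro _ ⟨s, hs1, hsk, f, hf, rfl⟩
  obtain ⟨φ, hφK, hφ, hL⟩ := exists_bilinearL_eq hk hk0 ht hf
  have hN : (N : ℂ) ≠ 0 := NeZero.ne _
  choose ℓ hℓ hℓW using fun (x y : ZMod N) (a : ℕ) =>
    exists_tendsto_LFunction_mul hK hk hs1 hsk (a := a) (signedSingle_mem a x)
      (signedSingle_mem (a + k) y) (signedSingle_neg a x) (signedSingle_neg (a + k) y)
  have hlim : Tendsto (bilinearL k φ) (𝓝[≠] (s : ℂ))
      (𝓝 (4⁻¹ * ∑ x, ∑ y, φ x y * ∑ a ∈ Finset.range 2, ℓ x y a)) := by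
    simp_rw [funext (bilinearL_eq_sum_signedSingle hφ)]
    exact (tendsto_finsetSum _ fun x _ => tendsto_finsetSum _ fun y _ =>
      (tendsto_finsetSum _ fun a _ => hℓ x y a).const_mul _).const_mul _
  have hLc : Continuous fun z : ℂ => (N : ℂ) ^ (-z) * ModularForm.L hk0 f z := by
    have := (differentiable_L_of_isZeroAt hk0 f hf.2.1 hf.2.2.1).continuous
    exact (continuous_neg.const_cpow (.inl hN)).mul this
  have heq : ∀ᶠ z : ℂ in 𝓝[≠] (s : ℂ),
      (N : ℂ) ^ (-z) * ModularForm.L hk0 f z = bilinearL k φ z := by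
    have h1 : ∀ᶠ z : ℂ in 𝓝[≠] (s : ℂ), z ≠ 1 := by
      rcases eq_or_ne (s : ℂ) 1 with h | h
      · rw [h]; exact self_mem_nhdsWithin
      · exact nhdsWithin_le_nhds (isOpen_ne.mem_nhds h)
    have h2 : ∀ᶠ z : ℂ in 𝓝[≠] (s : ℂ), z ≠ k := by
      have h : (s : ℂ) ≠ k := by
        have : s ≠ k := by omega
        exact_mod_cast this
      exact nhdsWithin_le_nhds (isOpen_ne.mem_nhds h)
    filter_upwards [h1, h2] with z hz1 hz2 using hL z hz1 hz2
  have hval := tendsto_nhds_unique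
    ((hLc.tendsto (s : ℂ)).mono_left nhdsWithin_le_nhds) (hlim.congr' (heq.mono fun _ h => h.symm))
  rw [cpow_neg, cpow_natCast] at hval
  have hval' : (2 * π : ℂ) ^ (k - 1 - s) * ModularForm.L hk0 f s =
      ∑ x, ∑ y, ∑ a ∈ Finset.range 2,
        (N ^ s * 4⁻¹ * φ x y) * ((2 * π) ^ (k - 1 - s) * ℓ x y a) := by
    have : ModularForm.L hk0 f s = N ^ s * (4⁻¹ * ∑ x, ∑ y, φ x y *
        ∑ a ∈ Finset.range 2, ℓ x y a) := by
      rw [← hval]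
      have := pow_ne_zero s hN
      field_simp
    rw [this]
    simp only [Finset.mul_sum]
    refine Finset.sum_congr rfl fun x _ => Finset.sum_congr rfl fun y _ =>
      Finset.sum_congr rfl fun a _ => ?_
    ring
  rw [SetLike.mem_coe, hval']
  refine sum_mem fun x _ => sum_mem fun y _ => sum_mem fun a _ => ?_
  exact (valueSpan K N k).smul_mem (⟨_, mul_mem (mul_mem (pow_mem (natCast_mem K N) s)
    (inv_mem (natCast_mem K 4))) (hφK x y)⟩ : K) (hℓW x y a)

end

/-! ### Levels `4` and `8`: trigonometric numbers and characters. -/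

noncomputable section

open UpperHalfPlane hiding I
open Complex ZMod Filter Topology

/-- Induction on the multiple of the angle by the addition formulas, carrying cosine and sine
together. -/
lemma ContainsTrig.of_one {K : IntermediateField ℚ ℂ} {N : ℕ} [NeZero N]
    (hc : 2 * cos (2 * π / N) ∈ K) (hs : 2 * sin (2 * π / N) ∈ K) : ContainsTrig K N := by
  have h1 : (stdAddChar (1 : ZMod N) : ℂ) = cexp (2 * π / N * I) := by
    have := stdAddChar_coe (N := N) 1
    rw [Int.cast_one] at this
    rw [this]; push_cast; congr 1; ring
  have h1' : (stdAddChar (-1 : ZMod N) : ℂ) = cexp (-(2 * π / N) * I) := by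
    have := stdAddChar_coe (N := N) (-1)
    rw [Int.cast_neg, Int.cast_one] at this
    rw [this]; push_cast; congr 1; ring
  have hc1 : (stdAddChar (1 : ZMod N) + stdAddChar (-1 : ZMod N) : ℂ) ∈ K := by
    rwa [h1, h1', ← two_cos]
  have hs1 : I * (stdAddChar (1 : ZMod N) - stdAddChar (-1 : ZMod N) : ℂ) ∈ K := by
    have := neg_mem hs
    rw [two_sin] at this
    rw [h1, h1']
    convert this using 1
    ring
  have hmul : (stdAddChar (1 : ZMod N) : ℂ) * stdAddChar (-1 : ZMod N) = 1 := by
    rw [← AddChar.map_add_eq_mul]; simp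
  have key (n : ℕ) : (stdAddChar (n : ZMod N) + stdAddChar (-n : ZMod N) : ℂ) ∈ K ∧
      I * (stdAddChar (n : ZMod N) - stdAddChar (-n : ZMod N) : ℂ) ∈ K := by
    induction n with
    | zero =>
      simp only [Nat.cast_zero, neg_zero, AddChar.map_zero_eq_one, sub_self, mul_zero]
      exact ⟨add_mem (one_mem K) (one_mem K), zero_mem K⟩
    | succ n ih =>
      have h2 := inv_mem (natCast_mem K 2)
      have e (n : ℕ) : (stdAddChar ((n + 1 : ℕ) : ZMod N) : ℂ) =
          stdAddChar (n : ZMod N) * stdAddChar (1 : ZMod N) := by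
        rw [← AddChar.map_add_eq_mul]; push_cast; rfl
      have e' (n : ℕ) : (stdAddChar (-((n + 1 : ℕ) : ZMod N)) : ℂ) =
          stdAddChar (-n : ZMod N) * stdAddChar (-1 : ZMod N) := by
        rw [← AddChar.map_add_eq_mul]; push_cast; congr 1; ring
      rw [e, e']
      constructor
      · convert mul_mem h2 (sub_mem (mul_mem ih.1 hc1) (mul_mem ih.2 hs1)) using 1
        push_cast
        linear_combination (-2⁻¹ * (stdAddChar (n : ZMod N) - stdAddChar (-n : ZMod N) : ℂ) *
          (stdAddChar (1 : ZMod N) - stdAddChar (-1 : ZMod N) : ℂ)) * (-I_sq)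
      · convert mul_mem h2 (add_mem (mul_mem ih.2 hc1) (mul_mem ih.1 hs1)) using 1
        push_cast
        ring
  have hj (j : ZMod N) : ((j.val : ℕ) : ZMod N) = j := natCast_zmod_val j
  exact ⟨fun j => by simpa [hj] using (key j.val).1, fun j => by simpa [hj] using (key j.val).2⟩

lemma containsTrig_four : ContainsTrig QField 4 := by
  have e : 2 * (π : ℂ) / (4 : ℕ) = π / 2 := by push_cast; ring
  refine .of_one ?_ ?_ <;> rw [e]
  · simp
  · rw [Complex.sin_pi_div_two, mul_one]; exact natCast_mem QField 2

lemma containsTrig_eight : ContainsTrig QSqrtTwo 8 := by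
  have e : 2 * (π : ℂ) / (8 : ℕ) = ((π / 4 : ℝ) : ℂ) := by push_cast; ring
  have h : ((√2 : ℝ) : ℂ) ∈ QSqrtTwo := IntermediateField.mem_adjoin_simple_self ℚ _
  refine .of_one ?_ ?_ <;> rw [e]
  · rw [← ofReal_cos, Real.cos_pi_div_four]; convert h using 1; push_cast; ring
  · rw [← ofReal_sin, Real.sin_pi_div_four]; convert h using 1; push_cast; ring

lemma LSeriesHasSum_spreadCoeff {t : ℕ} (ht : t ≠ 0) {a : ℕ → ℂ} {s S : ℂ} (hs : s ≠ 0)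
    (h : LSeriesHasSum a s S) : LSeriesHasSum (spreadCoeff t a) s (((t : ℂ) ^ s)⁻¹ * S) := by
  have e (f : ℕ → ℂ) : LSeries.term f s = fun n : ℕ => f n * ((n : ℂ) ^ s)⁻¹ := by
    funext n; rw [LSeries.term_of_ne_zero' hs, div_eq_mul_inv]
  rw [LSeriesHasSum, e] at h ⊢
  rw [hasSum_spreadCoeff_mul ht]
  have := h.mul_left ((t : ℂ) ^ s)⁻¹
  convert! this using 2 with n
  rw [Nat.cast_mul, natCast_mul_natCast_cpow, mul_inv]
  ring

lemma LFunction_eq_of_LSeriesHasSum {N : ℕ} [NeZero N] {Φ : ZMod N → ℂ} {f : ℕ → ℂ} {s S : ℂ}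
    (hs : 1 < s.re) (hf : ∀ n : ℕ, f n = Φ n) (h : LSeriesHasSum f s S) : LFunction Φ s = S := by
  rw [LFunction_eq_LSeries Φ hs, ← funext hf, h.LSeries_eq]

lemma LSeriesHasSum_one_riemannZeta {s : ℂ} (hs : 1 < s.re) :
    LSeriesHasSum 1 s (riemannZeta s) := by
  rw [← LSeries_one_eq_riemannZeta hs]
  exact (LSeriesSummable_one_iff.mpr hs).LSeriesHasSum

lemma LSeriesHasSum_LNegFour {s : ℂ} (hs : 1 < s.re) :
    LSeriesHasSum (fun n : ℕ => ((χ₄ n : ℤ) : ℂ)) s (LNegFour s) :=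
  (LSeriesSummable_of_one_lt_re (fun x : ZMod 4 => ((χ₄ x : ℤ) : ℂ)) hs).LSeriesHasSum

lemma LSeriesHasSum_LEight {s : ℂ} (hs : 1 < s.re) :
    LSeriesHasSum (fun n : ℕ => ((χ₈ n : ℤ) : ℂ)) s (LEight s) :=
  (LSeriesSummable_of_one_lt_re (fun x : ZMod 8 => ((χ₈ x : ℤ) : ℂ)) hs).LSeriesHasSum

lemma LSeriesHasSum_LNegEight {s : ℂ} (hs : 1 < s.re) :
    LSeriesHasSum (fun n : ℕ => ((χ₈' n : ℤ) : ℂ)) s (LNegEight s) :=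
  (LSeriesSummable_of_one_lt_re (fun x : ZMod 8 => ((χ₈' x : ℤ) : ℂ)) hs).LSeriesHasSum

/-- Even functions mod `4` are spanned by the indicators of `t ∣ n` for `t = 1, 2, 4`, whose series
are `t^(-s) ζ(s)`. -/
lemma LFunction_four_of_even {Φ : ZMod 4 → ℂ} (hΦ : Φ.Even) {s : ℂ} (hs : 1 < s.re) :
    LFunction Φ s = (Φ 1 + (Φ 2 - Φ 1) * (2 ^ s)⁻¹ + (Φ 0 - Φ 2) * (4 ^ s)⁻¹) * riemannZeta s := by
  have hs0 : s ≠ 0 := fun h => by simp [h] at hs; linarith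
  have h1 := LSeriesHasSum_one_riemannZeta hs
  have h2 := LSeriesHasSum_spreadCoeff two_ne_zero hs0 h1
  have h4 := LSeriesHasSum_spreadCoeff four_ne_zero hs0 h1
  have h := ((h1.smul (Φ 1)).add (h2.smul (Φ 2 - Φ 1))).add (h4.smul (Φ 0 - Φ 2))
  refine (LFunction_eq_of_LSeriesHasSum hs (fun n => ?_) h).trans
    (by push_cast; ring)
  · have h3 : Φ 3 = Φ 1 := hΦ 1
    simp only [Pi.add_apply, Pi.smul_apply, Pi.one_apply, smul_eq_mul, spreadCoeff]
    rw [← ZMod.natCast_mod n 4]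
    have hr : n % 4 < 4 := Nat.mod_lt _ (by norm_num)
    have hd2 : 2 ∣ n ↔ n % 4 % 2 = 0 := by omega
    have hd4 : 4 ∣ n ↔ n % 4 = 0 := by omega
    rw [if_congr hd2 rfl rfl, if_congr hd4 rfl rfl]
    generalize n % 4 = r at hr ⊢
    interval_cases r <;> simp [h3]

lemma LFunction_four_of_odd {Φ : ZMod 4 → ℂ} (hΦ : Φ.Odd) {s : ℂ} (hs : 1 < s.re) :
    LFunction Φ s = Φ 1 * LNegFour s := by
  refine LFunction_eq_of_LSeriesHasSum hs (fun n => ?_) ((LSeriesHasSum_LNegFour hs).smul (Φ 1))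
  have h0 : Φ 0 = -Φ 0 := hΦ 0
  have h2 : Φ 2 = -Φ 2 := hΦ 2
  have h3 : Φ 3 = -Φ 1 := hΦ 1
  rw [self_eq_neg] at h0 h2
  simp only [Pi.smul_apply, smul_eq_mul, χ₄_nat_eq_if_mod_four]
  rw [← ZMod.natCast_mod n 4, show n % 2 = n % 4 % 2 by omega]
  have hr : n % 4 < 4 := Nat.mod_lt _ (by norm_num)
  generalize n % 4 = r at hr ⊢
  interval_cases r <;> simp [h0, h2, h3]

/-- Divisibility indicators for `1, 2, 4, 8` do not separate `±1` from `±3`; `χ₈` does. -/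
lemma LFunction_eight_of_even {Φ : ZMod 8 → ℂ} (hΦ : Φ.Even) {s : ℂ} (hs : 1 < s.re) :
    LFunction Φ s = ((Φ 1 + Φ 3) / 2 + (Φ 2 - (Φ 1 + Φ 3) / 2) * (2 ^ s)⁻¹ +
      (Φ 4 - Φ 2) * (4 ^ s)⁻¹ + (Φ 0 - Φ 4) * (8 ^ s)⁻¹) * riemannZeta s +
      (Φ 1 - Φ 3) / 2 * LEight s := by
  have hs0 : s ≠ 0 := fun h => by simp [h] at hs; linarith
  have h1 := LSeriesHasSum_one_riemannZeta hs
  have h2 := LSeriesHasSum_spreadCoeff two_ne_zero hs0 h1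
  have h4 := LSeriesHasSum_spreadCoeff four_ne_zero hs0 h1
  have h8 := LSeriesHasSum_spreadCoeff (show 8 ≠ 0 by norm_num) hs0 h1
  have h := (((((h1.smul ((Φ 1 + Φ 3) / 2)).add (h2.smul (Φ 2 - (Φ 1 + Φ 3) / 2))).add
    (h4.smul (Φ 4 - Φ 2)))).add (h8.smul (Φ 0 - Φ 4))).add
      ((LSeriesHasSum_LEight hs).smul ((Φ 1 - Φ 3) / 2))
  refine (LFunction_eq_of_LSeriesHasSum hs (fun n => ?_) h).trans
    (by push_cast; ring)
  · have h5 : Φ 5 = Φ 3 := hΦ 3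
    have h6 : Φ 6 = Φ 2 := hΦ 2
    have h7 : Φ 7 = Φ 1 := hΦ 1
    simp only [Pi.add_apply, Pi.smul_apply, Pi.one_apply, smul_eq_mul, spreadCoeff,
      χ₈_nat_eq_if_mod_eight]
    rw [← ZMod.natCast_mod n 8]
    have hr : n % 8 < 8 := Nat.mod_lt _ (by norm_num)
    have hd2 : 2 ∣ n ↔ n % 8 % 2 = 0 := by omega
    have hd4 : 4 ∣ n ↔ n % 8 % 4 = 0 := by omega
    have hd8 : 8 ∣ n ↔ n % 8 = 0 := by omega
    rw [if_congr hd2 rfl rfl, if_congr hd4 rfl rfl, if_congr hd8 rfl rfl,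
      show n % 2 = n % 8 % 2 by omega]
    generalize n % 8 = r at hr ⊢
    interval_cases r <;> simp [h5, h6, h7] <;> ring

/-- The odd functions mod `8` form a three-dimensional space, with basis `χ₄`, `χ₈'` and `χ₄(n/2)`
supported on even `n`. -/
lemma LFunction_eight_of_odd {Φ : ZMod 8 → ℂ} (hΦ : Φ.Odd) {s : ℂ} (hs : 1 < s.re) :
    LFunction Φ s = ((Φ 1 - Φ 3) / 2 + Φ 2 * (2 ^ s)⁻¹) * LNegFour s +
      (Φ 1 + Φ 3) / 2 * LNegEight s := by
  have hs0 : s ≠ 0 := fun h => by simp [h] at hs; linarith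
  have h1 := LSeriesHasSum_LNegFour hs
  have h2 := LSeriesHasSum_spreadCoeff two_ne_zero hs0 h1
  have h := (((h1.smul ((Φ 1 - Φ 3) / 2)).add (h2.smul (Φ 2)))).add
      ((LSeriesHasSum_LNegEight hs).smul ((Φ 1 + Φ 3) / 2))
  refine (LFunction_eq_of_LSeriesHasSum hs (fun n => ?_) h).trans
    (by push_cast; ring)
  · have h0 : Φ 0 = -Φ 0 := hΦ 0
    have h4 : Φ 4 = -Φ 4 := hΦ 4
    have h5 : Φ 5 = -Φ 3 := hΦ 3
    have h6 : Φ 6 = -Φ 2 := hΦ 2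
    have h7 : Φ 7 = -Φ 1 := hΦ 1
    rw [self_eq_neg] at h0 h4
    simp only [Pi.add_apply, Pi.smul_apply, smul_eq_mul, spreadCoeff,
      χ₈'_nat_eq_if_mod_eight, χ₄_nat_eq_if_mod_four]
    rw [← ZMod.natCast_mod n 8]
    have hr : n % 8 < 8 := Nat.mod_lt _ (by norm_num)
    have hd2 : 2 ∣ n ↔ n % 8 % 2 = 0 := by omega
    rw [if_congr hd2 rfl rfl, show n % 2 = n % 8 % 2 by omega, show n % 4 = n % 8 % 4 by omega,
      show n / 2 % 2 = n % 8 / 2 % 2 by omega, show n / 2 % 4 = n % 8 / 2 by omega]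
    generalize n % 8 = r at hr ⊢
    interval_cases r <;> simp [h0, h4, h5, h6, h7] <;> ring

end

/-! ### Values at cusps, and the vanishing for `Γ₁(4)` in odd weight. -/

noncomputable section

open UpperHalfPlane hiding I
open Complex Filter Topology EisensteinSeries ModularForm
open scoped Matrix

/-- The points `(n + 1) i` of the upper half-plane. -/
def imaginarySeq (n : ℕ) : ℍ := ⟨(n + 1) * I, by simp; positivity⟩

lemma imaginarySeq_im (n : ℕ) : (imaginarySeq n).im = n + 1 := by
  simp [imaginarySeq, UpperHalfPlane.im]

lemma tendsto_imaginarySeq : Tendsto imaginarySeq atTop atImInfty := by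
  rw [atImInfty, tendsto_comap_iff]
  refine (tendsto_atTop_add_const_right _ 1 tendsto_natCast_atTop_atTop).congr fun n => ?_
  exact (imaginarySeq_im n).symm

lemma tendsto_eisSummand_imaginarySeq {k : ℕ} (hk : k ≠ 0) (v : Fin 2 → ℤ) :
    Tendsto (fun n => eisSummand k v (imaginarySeq n)) atTop
      (𝓝 (if v 0 = 0 then ((v 1 : ℂ) ^ k)⁻¹ else 0)) := by
  split_ifs with h
  · simp [eisSummand, h]
  · have h1 : Tendsto (fun n : ℕ => ‖((v 0 : ℂ) * (imaginarySeq n : ℂ) + v 1)‖) atTop atTop := by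
      refine tendsto_atTop_mono (fun n => ?_)
        (tendsto_atTop_add_const_right _ 1 (tendsto_natCast_atTop_atTop (R := ℝ)))
      have h2 := Complex.abs_im_le_norm ((v 0 : ℂ) * (imaginarySeq n : ℂ) + v 1)
      have h3 : ((v 0 : ℂ) * (imaginarySeq n : ℂ) + v 1).im = v 0 * (n + 1) := by
        simp [imaginarySeq]
      have h4 : (1 : ℝ) ≤ |(v 0 : ℝ)| := by exact_mod_cast Int.one_le_abs h
      rw [h3, abs_mul, abs_of_nonneg (by positivity : (0 : ℝ) ≤ n + 1)] at h2
      nlinarith [n.cast_nonneg (α := ℝ)]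
    rw [tendsto_zero_iff_norm_tendsto_zero]
    simp only [eisSummand, zpow_neg, zpow_natCast, norm_inv, norm_pow]
    exact tendsto_inv_atTop_zero.comp ((tendsto_pow_atTop hk).comp h1)

/-- The value of an Eisenstein series at the cusp `∞`. -/
def eisensteinValue {N : ℕ} (k : ℕ) (a : Fin 2 → ZMod N) : ℂ :=
  (if a = ![0, 1] then 1 else 0) + (-1) ^ k * (if a = -![0, 1] then 1 else 0)

/-- By dominated convergence only the coprime vectors with `c = 0` survive, namely `±(0,1)`. -/
lemma tendsto_eisensteinSeries_imaginarySeq {N k : ℕ} (hk : 3 ≤ k) (a : Fin 2 → ZMod N) :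
    Tendsto (fun n => eisensteinSeries a k (imaginarySeq n)) atTop (𝓝 (eisensteinValue k a)) := by
  classical
  have hE (z : ℍ) : eisensteinSeries a k z =
      ∑' v : Fin 2 → ℤ, (gammaSet N 1 a).indicator (fun v => eisSummand k v z) v := by
    rw [eisensteinSeries, ← tsum_subtype]
  have hk' : (2 : ℝ) < (k : ℤ) := by norm_cast
  have hlim := tendsto_tsum_of_dominated_convergence (𝓕 := atTop)
    (f := fun (n : ℕ) (v : Fin 2 → ℤ) =>
      (gammaSet N 1 a).indicator (fun v => eisSummand k v (imaginarySeq n)) v)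
    (g := fun v => (gammaSet N 1 a).indicator
      (fun v : Fin 2 → ℤ => if v 0 = 0 then ((v 1 : ℂ) ^ k)⁻¹ else 0) v)
    (bound := fun v : Fin 2 → ℤ => r ⟨⟨1, 1⟩, one_pos⟩ ^ (-((k : ℤ) : ℝ)) * ‖v‖ ^ (-((k : ℤ) : ℝ)))
    ((summable_one_div_norm_rpow hk').mul_left _) ?_ ?_
  · simp_rw [hE]
    convert hlim using 2
    have hne : (![0, 1] : Fin 2 → ℤ) ≠ -![0, 1] := by decide
    rw [tsum_eq_sum (s := {![0, 1], -![0, 1]}), Finset.sum_pair hne]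
    · have h1 : ((↑) ∘ (![0, 1] : Fin 2 → ℤ) : Fin 2 → ZMod N) = ![0, 1] := by ext i; fin_cases i <;> simp
      have h2 : ((↑) ∘ (-![0, 1] : Fin 2 → ℤ) : Fin 2 → ZMod N) = -![0, 1] := by
        ext i; fin_cases i <;> simp
      simp only [Set.indicator_apply, gammaSet, Set.mem_ofPred_eq, h1, h2, eisensteinValue,
        eq_comm (a := a)]
      have h3 : ((-1 : ℂ) ^ k)⁻¹ = (-1) ^ k := by
        rw [← inv_pow]; norm_num
      congr 1
      · simp
      · split_ifs <;> simp_all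
    · intro v hv
      refine Set.indicator_apply_eq_zero.mpr fun hmem => if_neg fun h0 => hv ?_
      have hg := hmem.2
      rw [h0, Int.gcd_zero_left] at hg
      have h1 : v 1 = 1 ∨ v 1 = -1 := Int.natAbs_eq_natAbs_iff.mp hg
      simp only [Finset.mem_insert, Finset.mem_singleton]
      refine h1.imp (fun h => ?_) (fun h => ?_) <;> ext i <;> fin_cases i <;> simp [h0, h]
  · intro v
    by_cases hv : v ∈ gammaSet N 1 a
    · simpa only [Set.indicator_of_mem hv] using tendsto_eisSummand_imaginarySeq (by omega) v
    · simpa only [Set.indicator_of_notMem hv] using tendsto_const_nhds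
  · refine Eventually.of_forall fun n v => (norm_indicator_le_norm_self _ _).trans ?_
    simp only [eisSummand, norm_zpow]
    have := summand_bound_of_mem_verticalStrip (A := 1) (B := 1) (z := imaginarySeq n)
      (k := (k : ℤ)) (by positivity) v one_pos ?_
    · exact_mod_cast this
    · rw [mem_verticalStrip_iff, imaginarySeq_im]
      constructor
      · simp [imaginarySeq, UpperHalfPlane.re]
      · linarith [n.cast_nonneg (α := ℝ)]

lemma eisensteinSeries_neg {N k : ℕ} (a : Fin 2 → ZMod N) (z : ℍ) :
    eisensteinSeries (-a) k z = (-1) ^ k * eisensteinSeries a k z := by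
  have h := congr_fun (eisensteinSeries_slash_apply a k (-1)) z
  have h1 : a ᵥ* (-1 : SL(2, ℤ)) = -a := by
    ext i; fin_cases i <;> simp [Matrix.vecMul, dotProduct]
  have h2 : ((-1 : ℂ) ^ k)⁻¹ = (-1) ^ k := by
    rw [← inv_pow]; norm_num
  rw [h1] at h
  rw [← h, SL_slash_apply]
  simp [UpperHalfPlane.denom, h2, mul_comm]

section GammaOneFour

/-- The group `Γ₁(4)` has three cusps, represented by `∞`, `0`, and an irregular one. -/
lemma eq_zero_of_forall_mem_Gamma1_four {V : SL(2, ℤ) → ℂ}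
    (hΓ : ∀ g ∈ CongruenceSubgroup.Gamma1 4, ∀ γ, V (g * γ) = V γ)
    (hT : ∀ γ, V (γ * ModularGroup.T) = V γ) (hneg : ∀ γ, V (-γ) = -V γ)
    (h1 : V 1 = 0) (hS : V ModularGroup.S = 0) (γ : SL(2, ℤ)) : V γ = 0 := by
  let C (γ : SL(2, ℤ)) : ZMod 4 := (γ 1 0 : ℤ)
  let D (γ : SL(2, ℤ)) : ZMod 4 := (γ 1 1 : ℤ)
  have hdet (γ : SL(2, ℤ)) : ((γ 0 0 : ℤ) : ZMod 4) * D γ - ((γ 0 1 : ℤ) : ZMod 4) * C γ = 1 := by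
    have := γ.det_coe
    rw [Matrix.det_fin_two] at this
    have h := congrArg (Int.cast : ℤ → ZMod 4) this
    push_cast at h
    exact h
  -- A coset of `Γ₁(4)` is determined by its bottom row mod `4`.
  have hrow {γ γ' : SL(2, ℤ)} (hC : C γ = C γ') (hD : D γ = D γ') : V γ = V γ' := by
    rw [← hΓ (γ * γ'⁻¹) ?_ γ', inv_mul_cancel_right]
    rw [CongruenceSubgroup.Gamma1_mem]
    have e := hdet γ
    have e' := hdet γ'
    rw [← hC, ← hD] at e'
    have e00 : (γ * γ'⁻¹) 0 0 = γ 0 0 * γ' 1 1 - γ 0 1 * γ' 1 0 := by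
      simp [Matrix.mul_apply, Matrix.adjugate_fin_two]; ring
    have e10 : (γ * γ'⁻¹) 1 0 = γ 1 0 * γ' 1 1 - γ 1 1 * γ' 1 0 := by
      simp [Matrix.mul_apply, Matrix.adjugate_fin_two]; ring
    have e11 : (γ * γ'⁻¹) 1 1 = γ 1 1 * γ' 0 0 - γ 1 0 * γ' 0 1 := by
      simp [Matrix.mul_apply, Matrix.adjugate_fin_two]; ring
    rw [e00, e10, e11]
    simp only [C, D] at hC hD e e'
    push_cast
    refine ⟨?_, ?_, ?_⟩
    · rw [← hC, ← hD]; linear_combination e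
    · linear_combination e'
    · rw [← hC, ← hD]; ring
  have hTC (γ) : C (γ * ModularGroup.T) = C γ := by
    simp [C, ModularGroup.coe_T, Matrix.mul_apply, Fin.sum_univ_two]
  have hTD (γ) : D (γ * ModularGroup.T) = C γ + D γ := by
    simp [C, D, ModularGroup.coe_T, Matrix.mul_apply, Fin.sum_univ_two]
  have hnC (γ) : C (-γ) = -C γ := by simp [C]
  have hnD (γ) : D (-γ) = -D γ := by simp [D]
  have hS' (γ : SL(2, ℤ)) (hc : C γ = 1) : V γ = 0 := by
    have key (n : ℕ) : V (γ * ModularGroup.T ^ n) = V γ ∧ C (γ * ModularGroup.T ^ n) = 1 ∧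
        D (γ * ModularGroup.T ^ n) = n + D γ := by
      induction n with
      | zero => simp [hc]
      | succ n ih =>
        rw [pow_succ, ← mul_assoc, hT, hTC, hTD, ih.1, ih.2.1, ih.2.2]
        refine ⟨rfl, rfl, ?_⟩
        push_cast; ring
    obtain ⟨e1, e2, e3⟩ := key (-D γ).val
    rw [← e1, ← hS]
    refine hrow (e2.trans ?_) (e3.trans ?_)
    · simp [C, ModularGroup.coe_S]
    · simp [D, ModularGroup.coe_S]
  have h1' (γ : SL(2, ℤ)) (hc : C γ = 0) (hd : D γ = 1) : V γ = 0 := by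
    rw [← h1]
    exact hrow (by simp [hc, C]) (by simp [hd, D])
  -- The last alternative includes the irregular cusp `c = 2`: there `T` sends `(c,d)` to `(-c,-d)`,
  -- so `V γ = -V γ`.
  have key : ∀ a b c d : ZMod 4, a * d - b * c = 1 →
      (c = 0 ∧ d = 1) ∨ (-c = 0 ∧ -d = 1) ∨ c = 1 ∨ -c = 1 ∨ (c = -c ∧ c + d = -d) := by decide
  rcases key _ _ _ _ (hdet γ) with h | h | h | h | h
  · exact h1' γ h.1 h.2
  · rw [← neg_eq_zero, ← hneg]
    exact h1' _ (by rw [hnC, h.1]) (by rw [hnD, h.2])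
  · exact hS' γ h
  · rw [← neg_eq_zero, ← hneg]
    exact hS' _ (by rw [hnC, h])
  · have : V γ = -V γ := by
      rw [← hneg, ← hT γ]
      exact hrow (by rw [hTC, hnC]; exact h.1) (by rw [hTD, hnD]; exact h.2)
    exact self_eq_neg.mp this

variable {k : ℕ}

/-- The cusp values recover every coefficient that matters. In odd weight `E_{-a} = -E_a`, so `f`
depends only on `h b = c b - c (-b)`, and `V γ`, the limit of `f ∣ γ` at `∞`, is one such number. -/
lemma eq_zero_of_mem_eisensteinZeroInfty_Gamma1_four (hk : 3 ≤ k) (hodd : Odd k)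
    {K : IntermediateField ℚ ℂ} {f : ModularForm (CongruenceSubgroup.Gamma1 4 : Subgroup (GL (Fin 2) ℝ)) k}
    (hf : f ∈ eisensteinZeroInfty K (CongruenceSubgroup.Gamma1 4) 4 k) (z : ℍ) : f z = 0 := by
  obtain ⟨hE, h0, hinf, -⟩ := hf
  obtain ⟨c, hc⟩ := (Submodule.mem_span_range_iff_exists_fun ℂ).mp hE
  have hf (z : ℍ) : f z = ∑ a, c a * eisensteinSeries a k z := by
    rw [← hc]; simp
  let w : Fin 2 → ZMod 4 := ![0, 1]
  let M (γ : SL(2, ℤ)) : Matrix (Fin 2) (Fin 2) (ZMod 4) :=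
    Matrix.SpecialLinearGroup.map (Int.castRingHom (ZMod 4)) γ
  have hMmul (γ γ' : SL(2, ℤ)) : M (γ * γ') = M γ * M γ' := by
    simp only [M, map_mul, Matrix.SpecialLinearGroup.coe_mul]
  have hM1 : M 1 = 1 := by simp [M]
  have hMneg (γ : SL(2, ℤ)) : M (-γ) = -M γ := by
    ext i j; simp [M]
  let h (b : Fin 2 → ZMod 4) : ℂ := c b - c (-b)
  let V (γ : SL(2, ℤ)) : ℂ := h (w ᵥ* M γ⁻¹)
  have hslash (γ : SL(2, ℤ)) (z : ℍ) :
      (⇑f ∣[(k : ℤ)] γ) z = ∑ a, c a * eisensteinSeries (a ᵥ* M γ) k z := by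
    rw [SL_slash_apply, hf, Finset.sum_mul]
    refine Finset.sum_congr rfl fun a _ => ?_
    rw [← eisensteinSeries_slash_apply, SL_slash_apply, mul_assoc]
  have hcancel (γ : SL(2, ℤ)) (a b : Fin 2 → ZMod 4) : a ᵥ* M γ = b ↔ a = b ᵥ* M γ⁻¹ := by
    constructor
    · rintro rfl
      rw [Matrix.vecMul_vecMul, ← hMmul, mul_inv_cancel, hM1, Matrix.vecMul_one]
    · rintro rfl
      rw [Matrix.vecMul_vecMul, ← hMmul, inv_mul_cancel, hM1, Matrix.vecMul_one]
  have hV (γ : SL(2, ℤ)) :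
      Tendsto (fun n => (⇑f ∣[(k : ℤ)] γ) (imaginarySeq n)) atTop (𝓝 (V γ)) := by
    simp_rw [hslash]
    have := tendsto_finsetSum Finset.univ fun a _ =>
      (tendsto_eisensteinSeries_imaginarySeq hk (a ᵥ* M γ)).const_mul (c a)
    convert this using 2
    simp only [eisensteinValue, hodd.neg_one_pow, hcancel, mul_add, Finset.sum_add_distrib]
    simp only [Matrix.neg_vecMul, mul_ite, mul_one, mul_zero, Finset.sum_ite_eq',
      Finset.mem_univ, if_true, V, h, w]
    simp [sub_eq_add_neg]
  have hVz {γ : SL(2, ℤ)} (hγ : IsZeroAtImInfty (⇑f ∣[(k : ℤ)] γ)) : V γ = 0 :=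
    tendsto_nhds_unique (hV γ) (hγ.comp tendsto_imaginarySeq)
  have hV0 := eq_zero_of_forall_mem_Gamma1_four (V := V) ?_ ?_ ?_ ?_ ?_
  · have hterm (a : Fin 2 → ZMod 4) : h a * eisensteinSeries a k z = 0 := by
      -- A class containing a coprime vector is the bottom row of some `γ` mod `4`, so `h a = V
      -- γ⁻¹`; any other class has the zero series.
      by_cases hne : (gammaSet 4 1 a).Nonempty
      · obtain ⟨v, hva, hvg⟩ := hne
        obtain ⟨γ, -, hγ⟩ := ModularGroup.bottom_row_surj (R := ℤ) (a := v)
          (Int.isCoprime_iff_gcd_eq_one.mpr hvg)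
        have ha : w ᵥ* M γ = a := by
          rw [← hva, ← hγ]
          ext i
          fin_cases i <;> simp [w, M, Matrix.vecMul, dotProduct]
        have := hV0 γ⁻¹
        simp only [V, inv_inv, ha] at this
        rw [this, zero_mul]
      · have : IsEmpty (gammaSet 4 1 a) := Set.isEmpty_coe_sort.mpr
          (Set.not_nonempty_iff_eq_empty.mp hne)
        rw [eisensteinSeries, tsum_empty, mul_zero]
    have h1 : f z = ∑ a, c (-a) * eisensteinSeries (-a) k z := by
      rw [hf]
      exact (Fintype.sum_equiv (Equiv.neg _) _ _ fun a => by simp)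
    have h2 : f z + f z = ∑ a, h a * eisensteinSeries a k z := by
      nth_rewrite 2 [h1]
      rw [hf, ← Finset.sum_add_distrib]
      refine Finset.sum_congr rfl fun a _ => ?_
      rw [eisensteinSeries_neg, hodd.neg_one_pow]
      ring
    rw [Finset.sum_eq_zero fun a _ => hterm a] at h2
    linear_combination h2 / 2
  · intro g hg γ
    refine tendsto_nhds_unique (hV (g * γ)) ?_
    have : ⇑f ∣[(k : ℤ)] g = ⇑f := SlashInvariantFormClass.slash_action_eq f _
      (Subgroup.mem_map_of_mem _ hg)
    rw [SlashAction.slash_mul, this]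
    exact hV γ
  · intro γ
    have : w ᵥ* M ModularGroup.T⁻¹ = w := by
      ext i
      fin_cases i <;> simp [w, M, Matrix.vecMul, dotProduct]
    simp only [V]
    rw [mul_inv_rev, hMmul, ← Matrix.vecMul_vecMul, this]
  · intro γ
    simp only [V, h]
    rw [inv_neg, hMneg, Matrix.vecMul_neg, neg_neg, neg_sub]
  · refine hVz ?_
    rw [SlashAction.slash_one]
    exact OnePoint.isZeroAt_infty_iff.mp hinf
  · refine hVz ?_
    exact h0 ModularGroup.S (by
      rw [OnePoint.smul_infty_eq_ite]
      simp [ModularGroup.coe_S])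

end GammaOneFour

end

/-! ### Conclusion for the three groups. -/

noncomputable section

open UpperHalfPlane hiding I
open Complex ZMod

variable {k : ℕ}

lemma valueSpan_le {K : IntermediateField ℚ ℂ} {N : ℕ} [NeZero N] {S : Submodule K ℂ}
    (hπ : (π : ℂ) ^ (k - 1) ∈ S)
    (hL : ∀ Φ : ZMod N → ℂ, (∀ x, Φ x ∈ K) → (∀ x, Φ (-x) = (-1) ^ k * Φ x) →
      LFunction Φ (k - 1 : ℕ) ∈ S) : valueSpan K N k ≤ S := by
  refine Submodule.span_le.mpr (Set.union_subset (by simpa using hπ) ?_)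
  rintro _ ⟨Φ, hΦ, hpar, rfl⟩
  exact hL Φ hΦ hpar

lemma Submodule.mul_mem_of_mem {K : IntermediateField ℚ ℂ} {S : Submodule K ℂ} {c z : ℂ}
    (hc : c ∈ K) (hz : z ∈ S) : c * z ∈ S :=
  S.smul_mem (⟨c, hc⟩ : K) hz

lemma one_lt_re_natCast_sub_one (hk : 3 ≤ k) : 1 < ((k - 1 : ℕ) : ℂ).re := by
  rw [natCast_re, Nat.one_lt_cast]
  omega

lemma inv_natCast_cpow_mem (K : IntermediateField ℚ ℂ) (t n : ℕ) : ((t : ℂ) ^ (n : ℂ))⁻¹ ∈ K := by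
  rw [cpow_natCast]
  exact inv_mem (pow_mem (natCast_mem K t) n)

lemma valueSpan_four_le_of_even (hk : 3 ≤ k) (he : Even k) {K : IntermediateField ℚ ℂ} :
    valueSpan K 4 k ≤ Submodule.span K {(π : ℂ) ^ (k - 1), riemannZeta ((k - 1 : ℕ) : ℂ)} := by
  refine valueSpan_le (Submodule.subset_span (by simp)) fun Φ hΦ hpar => ?_
  rw [LFunction_four_of_even (fun x => by rw [hpar, he.neg_one_pow, one_mul])
    (one_lt_re_natCast_sub_one hk)]
  refine Submodule.mul_mem_of_mem ?_ (Submodule.subset_span (by simp))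
  exact add_mem (add_mem (hΦ 1) (mul_mem (sub_mem (hΦ 2) (hΦ 1))
    (mod_cast inv_natCast_cpow_mem K 2 _))) (mul_mem (sub_mem (hΦ 0) (hΦ 2))
    (mod_cast inv_natCast_cpow_mem K 4 _))

lemma valueSpan_four_le_of_odd (hk : 3 ≤ k) (ho : Odd k) {K : IntermediateField ℚ ℂ} :
    valueSpan K 4 k ≤ Submodule.span K {(π : ℂ) ^ (k - 1), LNegFour ((k - 1 : ℕ) : ℂ)} := by
  refine valueSpan_le (Submodule.subset_span (by simp)) fun Φ hΦ hpar => ?_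
  rw [LFunction_four_of_odd (fun x => by rw [hpar, ho.neg_one_pow, neg_one_mul])
    (one_lt_re_natCast_sub_one hk)]
  exact Submodule.mul_mem_of_mem (hΦ 1) (Submodule.subset_span (by simp))

lemma valueSpan_eight_le_of_even (hk : 3 ≤ k) (he : Even k) {K : IntermediateField ℚ ℂ} :
    valueSpan K 8 k ≤ Submodule.span K
      {(π : ℂ) ^ (k - 1), riemannZeta ((k - 1 : ℕ) : ℂ), LEight ((k - 1 : ℕ) : ℂ)} := by
  refine valueSpan_le (Submodule.subset_span (by simp)) fun Φ hΦ hpar => ?_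
  rw [LFunction_eight_of_even (fun x => by rw [hpar, he.neg_one_pow, one_mul])
    (one_lt_re_natCast_sub_one hk)]
  have h2 : (2 : ℂ) ∈ K := natCast_mem K 2
  have h13 := div_mem (add_mem (hΦ 1) (hΦ 3)) h2
  refine add_mem (Submodule.mul_mem_of_mem ?_ (Submodule.subset_span (by simp)))
    (Submodule.mul_mem_of_mem (div_mem (sub_mem (hΦ 1) (hΦ 3)) h2)
      (Submodule.subset_span (by simp)))
  exact add_mem (add_mem (add_mem h13 (mul_mem (sub_mem (hΦ 2) h13)
    (mod_cast inv_natCast_cpow_mem K 2 _))) (mul_mem (sub_mem (hΦ 4) (hΦ 2))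
    (mod_cast inv_natCast_cpow_mem K 4 _))) (mul_mem (sub_mem (hΦ 0) (hΦ 4))
    (mod_cast inv_natCast_cpow_mem K 8 _))

lemma valueSpan_eight_le_of_odd (hk : 3 ≤ k) (ho : Odd k) {K : IntermediateField ℚ ℂ} :
    valueSpan K 8 k ≤ Submodule.span K
      {(π : ℂ) ^ (k - 1), LNegFour ((k - 1 : ℕ) : ℂ), LNegEight ((k - 1 : ℕ) : ℂ)} := by
  refine valueSpan_le (Submodule.subset_span (by simp)) fun Φ hΦ hpar => ?_
  rw [LFunction_eight_of_odd (fun x => by rw [hpar, ho.neg_one_pow, neg_one_mul])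
    (one_lt_re_natCast_sub_one hk)]
  have h2 : (2 : ℂ) ∈ K := natCast_mem K 2
  refine add_mem (Submodule.mul_mem_of_mem ?_ (Submodule.subset_span (by simp)))
    (Submodule.mul_mem_of_mem (div_mem (add_mem (hΦ 1) (hΦ 3)) h2)
      (Submodule.subset_span (by simp)))
  exact add_mem (div_mem (sub_mem (hΦ 1) (hΦ 3)) h2)
    (mul_mem (hΦ 2) (mod_cast inv_natCast_cpow_mem K 2 _))

lemma eisensteinLSpan_Gamma1_four_of_odd (hk : 3 ≤ k) (ho : Odd k) (hk0 : 0 < (k : ℤ))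
    {K : IntermediateField ℚ ℂ} :
    eisensteinLSpan K (CongruenceSubgroup.Gamma1 4) 4 k hk0 = ⊥ := by
  refine (Submodule.span_eq_bot).mpr ?_
  rintro _ ⟨s, -, -, f, hf, rfl⟩
  have hf0 := eq_zero_of_mem_eisensteinZeroInfty_Gamma1_four hk ho hf
  have hΛ : ModularForm.Λ hk0 f s = 0 := by
    have := congr_fun (isStrongFEPair_of_isZeroAt hk0 f hf.2.1 hf.2.2.1).Λ_eq s
    -- Without constant terms `Λ` is the plain Mellin transform, here of the zero function.
    refine this.trans ?_
    simp [mellin, ModularForm.weakFEPair, hf0]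
  rw [ModularForm.L, hΛ, zero_mul, mul_zero]

end

theorem mainTheorem4 (k : ℕ) (hk : 3 ≤ k) :
    (Even k →
      eisensteinLSpan QField (CongruenceSubgroup.Gamma1 4) 4 k (by omega) ≤
        Submodule.span QField {(π : ℂ) ^ (k - 1), riemannZeta ((k - 1 : ℕ) : ℂ)}) ∧
    (Odd k →
      eisensteinLSpan QField (CongruenceSubgroup.Gamma1 4) 4 k (by omega) ≤
        Submodule.span QField (∅ : Set ℂ)) ∧
    (Even k →
      eisensteinLSpan QField (CongruenceSubgroup.Gamma 4) 4 k (by omega) ≤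
        Submodule.span QField {(π : ℂ) ^ (k - 1), riemannZeta ((k - 1 : ℕ) : ℂ)}) ∧
    (Odd k →
      eisensteinLSpan QField (CongruenceSubgroup.Gamma 4) 4 k (by omega) ≤
        Submodule.span QField {(π : ℂ) ^ (k - 1), LNegFour ((k - 1 : ℕ) : ℂ)}) ∧
    (Even k →
      eisensteinLSpan QSqrtTwo (CongruenceSubgroup.Gamma1 8) 8 k (by omega) ≤
        Submodule.span QSqrtTwo
          {(π : ℂ) ^ (k - 1), riemannZeta ((k - 1 : ℕ) : ℂ), LEight ((k - 1 : ℕ) : ℂ)}) ∧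
    (Odd k →
      eisensteinLSpan QSqrtTwo (CongruenceSubgroup.Gamma1 8) 8 k (by omega) ≤
        Submodule.span QSqrtTwo
          {(π : ℂ) ^ (k - 1), LNegFour ((k - 1 : ℕ) : ℂ), LNegEight ((k - 1 : ℕ) : ℂ)}) := by
  have hk0 : 0 < (k : ℤ) := by omega
  -- In these three applications `t` is the level divided by the width of `∞`, which is `1` for
  -- `Γ₁(N)` and `N` for `Γ(N)`.
  have h4 : eisensteinLSpan QField (CongruenceSubgroup.Gamma1 4) 4 k hk0 ≤ valueSpan QField 4 k :=
    eisensteinLSpan_le_valueSpan containsTrig_four hk hk0 (t := 4) (by simp)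
  have h4' : eisensteinLSpan QField (CongruenceSubgroup.Gamma 4) 4 k hk0 ≤ valueSpan QField 4 k :=
    eisensteinLSpan_le_valueSpan containsTrig_four hk hk0 (t := 1) (by simp)
  have h8 : eisensteinLSpan QSqrtTwo (CongruenceSubgroup.Gamma1 8) 8 k hk0 ≤
      valueSpan QSqrtTwo 8 k :=
    eisensteinLSpan_le_valueSpan containsTrig_eight hk hk0 (t := 8) (by simp)
  refine ⟨fun he => h4.trans (valueSpan_four_le_of_even hk he), fun ho => ?_,
    fun he => h4'.trans (valueSpan_four_le_of_even hk he),
    fun ho => h4'.trans (valueSpan_four_le_of_odd hk ho),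
    fun he => h8.trans (valueSpan_eight_le_of_even hk he),
    fun ho => h8.trans (valueSpan_eight_le_of_odd hk ho)⟩
  rw [eisensteinLSpan_Gamma1_four_of_odd hk ho]
  exact bot_le
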